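/- Let $M$ be an uncountable compact metric space, and let $C(M,\mathbb T)$ be the Polish group of all continuous functions from $M$ to the circle group $\mathbb T$, with pointwise multiplication and the topology of uniform convergence. Then $C(M,\mathbb T)$ admits a whirly Boolean action on a separable atomless probability algebra. Explicitly, there are a standard Borel space $X$ and a Borel probability measure $\mu$ on $X$ such that the algebra $\mathcal B_\mu$ of Borel subsets of $X$ modulo $\mu$-null sets, with the metric $d_\mu(A,B)=\mu(A\triangle B)$, is separable and has no atoms, and there is a continuous homomorphism $\varphi\colon C(M,\mathbb T)\to\operatorname{Aut}(\mathcal B_\mu,\mu)$ into the group of measure-preserving automorphisms of the Boolean algebra $\mathcal B_\mu$ (with the topology of pointwise convergence with respect to $d_\mu$), with the following property: for every neighborhood $V$ of the identity in $C(M,\mathbb T)$ and all $A,B\in\mathcal B_\mu$ with $\mu(A)>0$ and $\mu(B)>0$, there is $g\in V$ with $\mu\big((\varphi(g)A)\cap B\big)>0$. -/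

import Mathlib

open MeasureTheory Topology Set
open scoped symmDiff

/-- Almost everywhere equality of measurable sets. -/
def MeasurableSet.aeSetoid {X : Type*} [MeasurableSpace X] (μ : Measure X) :
    Setoid {s : Set X // MeasurableSet s} where
  r s t := (s : Set X) =ᵐ[μ] (t : Set X)
  iseqv := ⟨fun _ => Filter.EventuallyEq.rfl, fun h => h.symm, fun h k => h.trans k⟩

/-- The measure algebra of `μ`: measurable sets modulo `μ`-null sets. -/
def MeasureAlgebra {X : Type*} [MeasurableSpace X] (μ : Measure X) : Type _ :=
  Quotient (MeasurableSet.aeSetoid μ)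

namespace MeasureAlgebra

variable {X : Type*} [MeasurableSpace X] {μ : Measure X}

/-- The class of a measurable set. -/
def mk (μ : Measure X) (s : Set X) (hs : MeasurableSet s) : MeasureAlgebra μ :=
  Quotient.mk (MeasurableSet.aeSetoid μ) ⟨s, hs⟩

theorem mk_eq_mk {s t : Set X} {hs : MeasurableSet s} {ht : MeasurableSet t} :
    mk μ s hs = mk μ t ht ↔ s =ᵐ[μ] t :=
  Quotient.eq (r := MeasurableSet.aeSetoid μ)

@[elab_as_elim]
theorem ind {p : MeasureAlgebra μ → Prop} (h : ∀ s hs, p (mk μ s hs)) (a : MeasureAlgebra μ) :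
    p a :=
  Quotient.inductionOn a fun s => h s.1 s.2

/-- The Boolean algebra structure induced by union, intersection and complement of sets; the order
is inclusion up to a null set. -/
instance : BooleanAlgebra (MeasureAlgebra μ) where
  le := Quotient.lift₂ (fun s t => (s : Set X) ≤ᵐ[μ] (t : Set X))
    fun _ _ _ _ h k => propext
      ⟨fun l => (h.symm.le.trans l).trans k.le, fun l => (h.le.trans l).trans k.symm.le⟩
  sup := Quotient.map₂ (fun s t => ⟨s.1 ∪ t.1, s.2.union t.2⟩)
    fun _ _ h _ _ k => Filter.EventuallyEq.union h k
  inf := Quotient.map₂ (fun s t => ⟨s.1 ∩ t.1, s.2.inter t.2⟩)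
    fun _ _ h _ _ k => Filter.EventuallyEq.inter h k
  compl := Quotient.map (fun s => ⟨s.1ᶜ, s.2.compl⟩) fun _ _ h => Filter.EventuallyEq.compl h
  top := mk μ univ .univ
  bot := mk μ ∅ .empty
  le_refl := ind fun s _ => Filter.EventuallyLE.refl _ s
  le_trans a b c := by
    induction a using ind; induction b using ind; induction c using ind
    exact Filter.EventuallyLE.trans
  le_antisymm a b := by
    induction a using ind; induction b using ind
    exact fun h k => mk_eq_mk.2 (Filter.EventuallyLE.antisymm h k)
  le_sup_left a b := by
    induction a using ind; induction b using ind
    exact Filter.Eventually.of_forall fun _ h => Or.inl h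
  le_sup_right a b := by
    induction a using ind; induction b using ind
    exact Filter.Eventually.of_forall fun _ h => Or.inr h
  sup_le a b c := by
    induction a using ind; induction b using ind; induction c using ind
    intro h k
    change _ ≤ᵐ[μ] _ at h k
    filter_upwards [h, k] with x hh hk hx
    exact Or.elim hx hh hk
  inf_le_left a b := by
    induction a using ind; induction b using ind
    exact Filter.Eventually.of_forall fun _ h => h.1
  inf_le_right a b := by
    induction a using ind; induction b using ind
    exact Filter.Eventually.of_forall fun _ h => h.2
  le_inf a b c := by
    induction a using ind; induction b using ind; induction c using ind
    intro h k
    change _ ≤ᵐ[μ] _ at h k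
    filter_upwards [h, k] with x hh hk hx
    exact ⟨hh hx, hk hx⟩
  le_sup_inf a b c := by
    induction a using ind; induction b using ind; induction c using ind
    exact Filter.Eventually.of_forall fun _ h => (Set.union_inter_distrib_left _ _ _).ge h
  inf_compl_le_bot a := by
    induction a using ind
    exact Filter.Eventually.of_forall fun _ h => h.2 h.1
  top_le_sup_compl a := by
    induction a using ind
    exact Filter.Eventually.of_forall fun x _ => Classical.em _
  le_top a := by
    induction a using ind
    exact Filter.Eventually.of_forall fun _ _ => trivial
  bot_le a := by
    induction a using ind
    exact Filter.Eventually.of_forall fun _ h => h.elim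

theorem mk_le_mk {s t : Set X} {hs : MeasurableSet s} {ht : MeasurableSet t} :
    mk μ s hs ≤ mk μ t ht ↔ s ≤ᵐ[μ] t := Iff.rfl

theorem mk_inf_mk {s t : Set X} (hs : MeasurableSet s) (ht : MeasurableSet t) :
    mk μ s hs ⊓ mk μ t ht = mk μ (s ∩ t) (hs.inter ht) := rfl

theorem mk_symmDiff_mk {s t : Set X} (hs : MeasurableSet s) (ht : MeasurableSet t) :
    mk μ s hs ∆ mk μ t ht = mk μ (s ∆ t) (hs.symmDiff ht) := rfl

/-- The measure of an element of the measure algebra. -/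
noncomputable def measure (a : MeasureAlgebra μ) : ℝ :=
  Quotient.lift (s := MeasurableSet.aeSetoid μ) (fun s => μ.real s.1)
    (fun _ _ h => measureReal_congr h) a

@[simp]
theorem measure_mk {s : Set X} (hs : MeasurableSet s) : (mk μ s hs).measure = μ.real s := rfl

/-- The metric `d(a, b) = μ (a ∆ b)`. -/
noncomputable instance [IsProbabilityMeasure μ] : MetricSpace (MeasureAlgebra μ) where
  dist a b := (a ∆ b).measure
  dist_self a := by
    induction a using ind
    rw [mk_symmDiff_mk, measure_mk]
    simp
  dist_comm a b := by rw [symmDiff_comm]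
  dist_triangle a b c := by
    induction a using ind; induction b using ind; induction c using ind
    simp only [mk_symmDiff_mk, measure_mk]
    exact measureReal_symmDiff_le _ (measure_ne_top _ _) (measure_ne_top _ _)
  eq_of_dist_eq_zero {a b} := by
    induction a using ind; induction b using ind
    simp only [mk_symmDiff_mk, measure_mk]
    intro h
    rw [measureReal_eq_zero_iff] at h
    exact mk_eq_mk.2 (measure_symmDiff_eq_zero_iff.1 h)

theorem dist_def [IsProbabilityMeasure μ] (a b : MeasureAlgebra μ) :
    dist a b = (a ∆ b).measure := rfl

/-- The group of measure-preserving automorphisms of the measure algebra. (An order isomorphism of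
a Boolean algebra is the same thing as an isomorphism of Boolean algebras.) The group operation is
composition. -/
def Aut (μ : Measure X) : Subgroup (MeasureAlgebra μ ≃o MeasureAlgebra μ) where
  carrier := {T | ∀ a, (T a).measure = a.measure}
  mul_mem' {S T} hS hT a := (hS (T a)).trans (hT a)
  one_mem' _ := rfl
  inv_mem' {T} hT a := by
    have h := hT (T⁻¹ a)
    rwa [RelIso.apply_inv_self, eq_comm] at h

/-- The topology of pointwise convergence on the automorphism group. -/
noncomputable instance [IsProbabilityMeasure μ] : TopologicalSpace (Aut μ) :=
  TopologicalSpace.induced (fun T a => (T : MeasureAlgebra μ ≃o MeasureAlgebra μ) a)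
    (inferInstanceAs (TopologicalSpace (MeasureAlgebra μ → MeasureAlgebra μ)))

/-- The measure algebra has no atoms. -/
def IsAtomless (μ : Measure X) : Prop :=
  ∀ a : MeasureAlgebra μ, ¬ IsAtom a

end MeasureAlgebra

/-- A measure-preserving Boolean action of a topological group `G` on the measure algebra of `μ`:
a continuous homomorphism from `G` to the automorphism group. -/
structure BooleanAction (G : Type*) [Group G] [TopologicalSpace G]
    {X : Type*} [MeasurableSpace X] (μ : Measure X) [IsProbabilityMeasure μ] where
  toHom : G →* MeasureAlgebra.Aut μ
  continuous_toHom : Continuous toHom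

namespace BooleanAction

variable {G : Type*} [Group G] [TopologicalSpace G]
  {X : Type*} [MeasurableSpace X] {μ : Measure X} [IsProbabilityMeasure μ]

/-- The element `g • a` of the measure algebra. -/
def act (φ : BooleanAction G μ) (g : G) (a : MeasureAlgebra μ) : MeasureAlgebra μ :=
  (φ.toHom g : MeasureAlgebra μ ≃o MeasureAlgebra μ) a

/-- A Boolean action is whirly if every neighbourhood of the identity contains, for any two
elements of positive measure, an element moving the first so that it meets the second in positive
measure. -/
def IsWhirly (φ : BooleanAction G μ) : Prop :=
  ∀ V ∈ 𝓝 (1 : G), ∀ a b : MeasureAlgebra μ, 0 < a.measure → 0 < b.measure →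
    ∃ g ∈ V, 0 < (φ.act g a ⊓ b).measure

end BooleanAction

/-! The space `M` contains a Cantor set, and `C(M, Circle)` acts through restriction to it by
multiplication on `L²(ℕ → Bool; ℂ)`, viewed as a real Hilbert space `H`. The Gaussian functor turns
an isometry `U` of `H` into a measure-preserving map `rotate b U` of the Gaussian space `ι → ℝ`,
where `ι` indexes a Hilbert basis `b`. Composition is respected almost everywhere, and strong
convergence to the identity becomes convergence on the measure algebra, so a Boolean action results.

Whirliness comes from a weak limit. Every neighbourhood of `1` contains, for one `δ` with `sin δ ≠
0` and all `n`, a function equal to `exp (± I δ)` on the Cantor set, the sign being that of the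
`n`-th coordinate. On Walsh functions not involving `n`, multiplication by it is `cos δ` plus an
orthogonal part; thus as `n` grows these operators tend weakly to the scalar `cos δ`. On finitely
many coordinates the pair `(x, rotate b U x)` then has exactly the law of `(x, cos δ • x + sin δ •
y)` with `y` an independent copy (`measure_setOf_restrict_rotate`).

The latter pair charges `A × B` whenever `A` and `B` have positive measure
(`measure_setOf_add_mem_pos`, by quasi-invariance under finitely supported shifts and the zero-one
law), and cylinder approximation carries this over to the action
(`exists_finset_forall_measure_inter_pos`). Atomlessness is a consequence of whirliness. -/

open ProbabilityTheory Filter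

/-! ### The standard Gaussian measure on `ι → ℝ` -/

/-- The product of standard Gaussian measures on `ι → ℝ`. -/
noncomputable def gaussianPi (ι : Type*) : Measure (ι → ℝ) :=
  Measure.infinitePi fun _ => gaussianReal 0 1

namespace gaussianPi

variable {ι : Type*}

instance : IsProbabilityMeasure (gaussianPi ι) :=
  inferInstanceAs (IsProbabilityMeasure (Measure.infinitePi fun _ : ι => gaussianReal 0 1))

/-- Resampling one coordinate preserves the Gaussian measure. -/
theorem map_update [DecidableEq ι] (i : ι) :
    ((gaussianPi ι).prod (gaussianReal 0 1)).map (fun p => Function.update p.1 i p.2)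
      = gaussianPi ι := by
  refine Measure.eq_infinitePi _ fun s t ht => ?_
  have hm : Measurable fun p : (ι → ℝ) × ℝ => Function.update p.1 i p.2 := measurable_update'
  rw [Measure.map_apply hm (MeasurableSet.pi s.countable_toSet fun j _ => ht j)]
  by_cases hi : i ∈ s
  · have : (fun p : (ι → ℝ) × ℝ => Function.update p.1 i p.2) ⁻¹' (Set.pi s t)
        = (Set.pi (s.erase i : Finset ι) t) ×ˢ t i := by
      ext p
      simp only [mem_preimage, Set.mem_pi, Finset.mem_coe, mem_prod, Finset.mem_erase]
      constructor
      · intro h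
        refine ⟨fun j hj => ?_, ?_⟩
        · simpa [Function.update_of_ne hj.1] using h j hj.2
        · simpa using h i hi
      · rintro ⟨h, h'⟩ j hj
        by_cases hji : j = i
        · subst hji; simpa using h'
        · simpa [Function.update_of_ne hji] using h j ⟨hji, hj⟩
    rw [this, Measure.prod_prod, gaussianPi, Measure.infinitePi_pi _ fun j _ => ht j,
      Finset.prod_erase_mul _ _ hi]
  · have : (fun p : (ι → ℝ) × ℝ => Function.update p.1 i p.2) ⁻¹' (Set.pi s t)
        = (Set.pi s t) ×ˢ univ := by
      ext p
      simp only [mem_preimage, Set.mem_pi, Finset.mem_coe, mem_prod, mem_univ, and_true]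
      refine forall₂_congr fun j hj => ?_
      rw [Function.update_of_ne (by rintro rfl; exact hi hj)]
    rw [this, Measure.prod_prod, gaussianPi, Measure.infinitePi_pi _ fun j _ => ht j]
    simp

/-- The Gaussian measure is quasi-invariant under translations along a coordinate. -/
theorem map_add_single_absolutelyContinuous [DecidableEq ι] (i : ι) (t : ℝ) :
    (gaussianPi ι).map (· + Pi.single i t) ≪ gaussianPi ι := by
  have hm : Measurable fun p : (ι → ℝ) × ℝ => Function.update p.1 i p.2 := measurable_update'
  have hac : (gaussianReal 0 1).map (· + t) ≪ gaussianReal 0 1 := by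
    rw [gaussianReal_map_add_const]
    exact (gaussianReal_absolutelyContinuous _ one_ne_zero).trans
      (gaussianReal_absolutelyContinuous' _ one_ne_zero)
  -- After coordinate `i` is resampled, the translation affects only the fresh independent variable,
  -- so the claim reduces to dimension one.
  have key : (gaussianPi ι).map (· + Pi.single i t)
      = (((gaussianPi ι).prod ((gaussianReal 0 1).map (· + t))).map
          fun p => Function.update p.1 i p.2) := by
    have h1 : (gaussianPi ι).prod ((gaussianReal 0 1).map (· + t))
        = ((gaussianPi ι).prod (gaussianReal 0 1)).map (Prod.map id (· + t)) := by
      rw [← Measure.map_prod_map _ _ measurable_id (by fun_prop), Measure.map_id]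
    rw [h1, Measure.map_map hm (by fun_prop)]
    conv_lhs => rw [← map_update i]
    rw [Measure.map_map (by fun_prop) hm]
    congr 1
    ext p j
    by_cases h : j = i
    · subst h; simp
    · simp [h]
  rw [key]
  conv_rhs => rw [← map_update i]
  exact (Measure.AbsolutelyContinuous.rfl.prod hac).map hm

/-- The Gaussian measure is quasi-invariant under finitely supported translations. -/
theorem map_add_absolutelyContinuous (d : ι → ℝ) (hd : d.support.Finite) :
    (gaussianPi ι).map (· + d) ≪ gaussianPi ι := by
  classical
  obtain ⟨f, rfl⟩ : ∃ f : ι →₀ ℝ, d = f := ⟨Finsupp.ofSupportFinite d hd, rfl⟩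
  clear hd
  induction f using Finsupp.induction_linear with
  | zero => simp [Measure.AbsolutelyContinuous.rfl]
  | add f g hf hg =>
    have : (fun x : ι → ℝ => x + ⇑(f + g)) = (· + ⇑g) ∘ (· + ⇑f) := by
      ext x i; simp [add_assoc]
    rw [this, ← Measure.map_map (by fun_prop) (by fun_prop)]
    exact (hf.map (by fun_prop)).trans hg
  | single i t =>
    rw [Finsupp.single_eq_pi_single]
    exact map_add_single_absolutelyContinuous i t

/-- Kolmogorov's zero-one law: an event that does not depend on any finite set of coordinates has
probability zero or one. -/
theorem measure_eq_zero_or_one {N : Set (ι → ℝ)} (hN : MeasurableSet N)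
    (h : ∀ x y : ι → ℝ, (x - y).support.Finite → x ∈ N → y ∈ N) :
    gaussianPi ι N = 0 ∨ gaussianPi ι N = 1 := by
  classical
  let s : ι → MeasurableSpace (ι → ℝ) := fun i => MeasurableSpace.comap (fun x => x i) inferInstance
  have hind : iIndep s (gaussianPi ι) := by
    have := iIndepFun_infinitePi (P := fun _ : ι => gaussianReal 0 1) (X := fun _ x => x)
      fun _ => measurable_id
    exact this
  refine measure_zero_or_one_of_measurableSet_limsup (s := s) (f := cofinite) (p := Set.Finite)
    (ns := fun F : Finset ι => (F : Set ι)) (fun i => (measurable_pi_apply i).comap_le) hind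
    (fun t ht => ht.compl_mem_cofinite) ?_ (fun F => F.finite_toSet) (fun i => ⟨{i}, by simp⟩) ?_
  · exact (directed_of_isDirected_le fun F G hFG => by simpa using hFG)
  · rw [hasBasis_cofinite.limsup_eq_iInf_iSup]
    simp only [MeasurableSpace.measurableSet_iInf]
    intro t ht
    -- Zeroing the finitely many coordinates in `t` does not affect membership in `N`, so `N = z ⁻¹'
    -- N` depends only on the coordinates outside `t`.
    let z : (ι → ℝ) → (ι → ℝ) := fun x i => if i ∈ t then 0 else x i
    have hz : z ⁻¹' N = N := by
      have hfin (x : ι → ℝ) : (x - z x).support.Finite := ht.subset fun i hi => by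
        by_contra hit
        simp [z, hit] at hi
      ext x
      refine ⟨fun hx => h _ _ ?_ hx, fun hx => h _ _ (hfin x) hx⟩
      rw [← neg_sub, Function.support_neg]
      exact hfin x
    rw [← hz]
    refine (?_ : @Measurable _ _ (⨆ i ∈ tᶜ, s i) MeasurableSpace.pi z) hN
    refine @measurable_pi_iff _ _ _ (⨆ i ∈ tᶜ, s i) _ _ |>.2 fun i => ?_
    by_cases hi : i ∈ t
    · simp only [z, hi, if_true]; exact measurable_const
    · simp only [z, hi, if_false]
      exact Measurable.of_comap_le (le_iSup₂_of_le i hi le_rfl)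

/-- The transition kernels of the Ornstein-Uhlenbeck semigroup are positivity improving. -/
theorem measure_setOf_add_mem_pos [Countable ι] {c s : ℝ} (hs : s ≠ 0)
    (hmap : ((gaussianPi ι).prod (gaussianPi ι)).map (fun p => c • p.1 + s • p.2) = gaussianPi ι)
    {A B : Set (ι → ℝ)} (hA : MeasurableSet A) (hB : MeasurableSet B)
    (hA0 : gaussianPi ι A ≠ 0) (hB0 : gaussianPi ι B ≠ 0) :
    (gaussianPi ι).prod (gaussianPi ι) {p | p.1 ∈ A ∧ c • p.1 + s • p.2 ∈ B} ≠ 0 := by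
  set γ := gaussianPi ι
  have hm : Measurable fun p : (ι → ℝ) × (ι → ℝ) => c • p.1 + s • p.2 := by fun_prop
  set S := (fun p : (ι → ℝ) × (ι → ℝ) => c • p.1 + s • p.2) ⁻¹' B with hS
  have hSm : MeasurableSet S := hm hB
  -- `N` consists of the points from which the kernel does not reach `B`. If the claim fails, `N`
  -- contains almost all of `A`; by the zero-one law it is then conull, which forces `B` to be null.
  set N := {x | γ (Prod.mk x ⁻¹' S) = 0} with hN
  have hNm : MeasurableSet N :=
    measurable_measure_prodMk_left hSm (measurableSet_singleton 0)
  intro h0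
  have hAm : MeasurableSet {p : (ι → ℝ) × (ι → ℝ) | p.1 ∈ A ∧ c • p.1 + s • p.2 ∈ B} :=
    (measurable_fst hA).inter hSm
  have hAN : ∀ᵐ x ∂γ, x ∈ A → x ∈ N := by
    filter_upwards [(Measure.measure_prod_null hAm).1 h0] with x hx hxA
    simp only [Pi.zero_apply] at hx
    refine measure_mono_null (fun y hy => ?_) hx
    exact ⟨hxA, hy⟩
  have hN01 := measure_eq_zero_or_one hNm fun x y hxy hx => by
    -- This `d` solves `c • x + s • (z + d) = c • y + s • z`: moving the starting point from `x` to
    -- `y` amounts to shifting the noise by `d`.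
    set d : ι → ℝ := (s⁻¹ * c) • (y - x) with hd
    have hdfin : d.support.Finite := by
      refine (hxy.subset fun i hi => ?_)
      simp only [hd, Function.mem_support, Pi.smul_apply, Pi.sub_apply, smul_eq_mul] at hi ⊢
      intro h
      exact hi (by rw [← neg_sub, h]; simp)
    have hac := map_add_absolutelyContinuous d hdfin hx
    rw [Measure.map_apply (by fun_prop) (measurable_prodMk_left hSm)] at hac
    refine measure_mono_null (fun z hz => ?_) hac
    simp only [mem_preimage, hS] at hz ⊢
    convert hz using 1
    ext i
    simp only [hd, Pi.add_apply, Pi.smul_apply, Pi.sub_apply, smul_eq_mul]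
    field_simp
    ring
  rcases hN01 with h | h
  · exact hA0 (measure_mono_null_ae hAN h)
  · have hae : ∀ᵐ x ∂γ, x ∈ N := (prob_compl_eq_zero_iff hNm).2 h
    have hS0 : γ.prod γ S = 0 := (Measure.measure_prod_null hSm).2 hae
    apply hB0
    rw [← hmap, Measure.map_apply hm hB]
    exact hS0

end gaussianPi

/-! ### Characteristic functions -/

open Complex in
/-- The joint law of finitely many real random variables is determined by its characteristic
function. -/
theorem map_eq_map_of_integral_exp_eq {κ Ω Ω' : Type*} [Fintype κ] [MeasurableSpace Ω]
    [MeasurableSpace Ω'] {P : Measure Ω} {P' : Measure Ω'} [IsFiniteMeasure P] [IsFiniteMeasure P']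
    {Y : Ω → κ → ℝ} {Y' : Ω' → κ → ℝ} (hY : Measurable Y) (hY' : Measurable Y')
    (h : ∀ t : κ → ℝ, ∫ ω, exp ((∑ i, t i * Y ω i : ℝ) * I) ∂P
      = ∫ ω, exp ((∑ i, t i * Y' ω i : ℝ) * I) ∂P') :
    P.map Y = P'.map Y' := by
  classical
  refine Measure.ext_of_charFunDual (funext fun L => ?_)
  have hL (v : κ → ℝ) : L v = ∑ i, L (Pi.single i 1) * v i := by
    conv_lhs => rw [pi_eq_sum_univ' v]
    simp [map_sum, mul_comm]
  rw [charFunDual_apply, charFunDual_apply, integral_map hY.aemeasurable (by fun_prop),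
    integral_map hY'.aemeasurable (by fun_prop)]
  simpa only [← hL] using h fun i => L (Pi.single i 1)

namespace gaussianPi

variable {ι : Type*}

open Complex in
theorem integral_exp_sum (F : Finset ι) (t : ι → ℝ) :
    ∫ x, exp ((∑ i ∈ F, t i * x i : ℝ) * I) ∂gaussianPi ι
      = exp ((-(∑ i ∈ F, t i ^ 2) / 2 : ℝ)) := by
  have h1 := integral_restrict_infinitePi (μ := fun _ : ι => gaussianReal 0 1) (s := F)
    (f := fun y => ∏ i : F, exp ((t i * y i : ℝ) * I))
    (Continuous.aestronglyMeasurable (by fun_prop))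
  have h2 (x : ι → ℝ) : exp ((∑ i ∈ F, t i * x i : ℝ) * I)
      = ∏ i : F, exp ((t i * F.restrict x i : ℝ) * I) := by
    rw [← Complex.exp_sum, ← Finset.sum_mul]
    simp only [Finset.restrict, ← ofReal_sum]
    rw [← Finset.sum_coe_sort F]
  simp only [h2, gaussianPi]
  rw [h1, integral_fintype_prod_eq_prod (μ := fun _ => gaussianReal 0 1)
    (f := fun (i : F) (y : ℝ) => exp ((t i * y : ℝ) * I))]
  have h3 (i : F) : ∫ y, exp ((t i * y : ℝ) * I) ∂gaussianReal 0 1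
      = exp ((-(t i ^ 2) / 2 : ℝ)) := by
    have := charFun_gaussianReal (μ := 0) (v := 1) (t i)
    rw [charFun_apply_real] at this
    simp only [ofReal_mul]
    rw [this]
    push_cast
    congr 1
    simp
    ring
  simp only [h3]
  rw [← Complex.exp_sum, ← ofReal_sum, ← Finset.sum_div, Finset.sum_neg_distrib,
    Finset.sum_coe_sort F (fun i => t i ^ 2)]

open Complex in
/-- A random element of `ι → ℝ` with standard Gaussian characteristic function has law
`gaussianPi ι`. -/
theorem map_eq_of_integral_exp_sum {Ω : Type*} [MeasurableSpace Ω] {P : Measure Ω}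
    [IsProbabilityMeasure P] {Y : Ω → ι → ℝ} (hY : Measurable Y)
    (h : ∀ (F : Finset ι) (t : ι → ℝ), ∫ ω, exp ((∑ i ∈ F, t i * Y ω i : ℝ) * I) ∂P
      = exp ((-(∑ i ∈ F, t i ^ 2) / 2 : ℝ))) :
    P.map Y = gaussianPi ι := by
  classical
  have hprob : IsProbabilityMeasure (P.map Y) := Measure.isProbabilityMeasure_map hY.aemeasurable
  refine IsProjectiveLimit.unique (P := fun F : Finset ι => (gaussianPi ι).map F.restrict)
    (fun F => ?_) fun F => rfl
  rw [Measure.map_map (by fun_prop) hY]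
  refine map_eq_map_of_integral_exp_eq (by fun_prop) (by fun_prop) fun t => ?_
  set t' : ι → ℝ := fun i => if hi : i ∈ F then t ⟨i, hi⟩ else 0 with ht'
  have key (v : ι → ℝ) : ∑ i : F, t i * v i = ∑ i ∈ F, t' i * v i := by
    rw [← Finset.sum_coe_sort F]
    refine Finset.sum_congr rfl fun i _ => ?_
    simp [ht']
  simp only [Function.comp_apply, Finset.restrict, key, h, integral_exp_sum]

open Complex in
-- Regrouping separates the independent variables, with coefficients `t + c r` and `s r`. The case
-- `t = 0` gives rotation invariance; the general case is the joint law to be matched by `rotate`.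
theorem integral_exp_sum_rotation (F : Finset ι) (t r : ι → ℝ) (c s : ℝ) (hcs : c ^ 2 + s ^ 2 = 1) :
    ∫ p, exp ((∑ i ∈ F, t i * p.1 i + ∑ i ∈ F, r i * (c • p.1 + s • p.2) i : ℝ) * I)
        ∂(gaussianPi ι).prod (gaussianPi ι)
      = exp ((-(∑ i ∈ F, t i ^ 2 + 2 * (c * ∑ i ∈ F, t i * r i) + ∑ i ∈ F, r i ^ 2) / 2 : ℝ)) := by
  have h1 (p : (ι → ℝ) × (ι → ℝ)) :
      exp ((∑ i ∈ F, t i * p.1 i + ∑ i ∈ F, r i * (c • p.1 + s • p.2) i : ℝ) * I)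
      = exp ((∑ i ∈ F, (t i + c * r i) * p.1 i : ℝ) * I) *
        exp ((∑ i ∈ F, (s * r i) * p.2 i : ℝ) * I) := by
    rw [← Complex.exp_add, ← add_mul, ← ofReal_add, ← Finset.sum_add_distrib,
      ← Finset.sum_add_distrib]
    congr 3
    refine Finset.sum_congr rfl fun i _ => ?_
    simp only [Pi.add_apply, Pi.smul_apply, smul_eq_mul]
    ring
  simp only [h1]
  rw [integral_prod_mul (fun x : ι → ℝ => exp ((∑ i ∈ F, (t i + c * r i) * x i : ℝ) * I))
    (fun x : ι → ℝ => exp ((∑ i ∈ F, (s * r i) * x i : ℝ) * I)), integral_exp_sum,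
    integral_exp_sum, ← Complex.exp_add, ← ofReal_add]
  congr 2
  rw [← add_div, ← neg_add, Finset.mul_sum, Finset.mul_sum, ← Finset.sum_add_distrib,
    ← Finset.sum_add_distrib, ← Finset.sum_add_distrib]
  congr 2
  refine Finset.sum_congr rfl fun i _ => ?_
  linear_combination (r i) ^ 2 * hcs

theorem map_rotation {c s : ℝ} (hcs : c ^ 2 + s ^ 2 = 1) :
    ((gaussianPi ι).prod (gaussianPi ι)).map (fun p => c • p.1 + s • p.2) = gaussianPi ι := by
  refine map_eq_of_integral_exp_sum (by fun_prop) fun F t => ?_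
  have := integral_exp_sum_rotation F 0 t c s hcs
  simpa using this

end gaussianPi

/-! ### The isonormal Gaussian process -/

section Lp

variable {Ω : Type*} [MeasurableSpace Ω] {P : Measure Ω}

theorem integral_abs_sub_le_norm_sub [IsProbabilityMeasure P] (f g : Lp ℝ 2 P) :
    ∫ x, |f x - g x| ∂P ≤ ‖f - g‖ := by
  have h1 : ∫ x, |f x - g x| ∂P = (eLpNorm (⇑f - ⇑g) 1 P).toReal := by
    rw [eLpNorm_one_eq_lintegral_enorm, ← integral_norm_eq_lintegral_enorm
      ((Lp.aestronglyMeasurable f).sub (Lp.aestronglyMeasurable g))]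
    rfl
  rw [h1, Lp.norm_def, eLpNorm_congr_ae (Lp.coeFn_sub f g)]
  refine ENNReal.toReal_mono ?_ (eLpNorm_le_eLpNorm_of_exponent_le (by norm_num)
    ((Lp.aestronglyMeasurable f).sub (Lp.aestronglyMeasurable g)))
  exact ((Lp.memLp f).sub (Lp.memLp g)).eLpNorm_ne_top

open Complex in
-- The map is 1-Lipschitz, because `|exp (I a) - exp (I b)| ≤ |a - b|` and the `L¹` norm is at most
-- the `L²` norm on a probability space.
theorem continuous_integral_exp_Lp [IsProbabilityMeasure P] :
    Continuous fun f : Lp ℝ 2 P => ∫ x, exp ((f x : ℝ) * I) ∂P := by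
  have hint (f : Lp ℝ 2 P) : Integrable (fun x => exp ((f x : ℝ) * I)) P := by
    refine Integrable.of_bound (C := 1) ?_ (ae_of_all _ fun x => by rw [norm_exp_ofReal_mul_I])
    have := Lp.aestronglyMeasurable f
    fun_prop
  refine (LipschitzWith.of_dist_le_mul (K := 1) fun f g => ?_).continuous
  rw [dist_eq_norm, dist_eq_norm, ← integral_sub (hint f) (hint g), NNReal.coe_one, one_mul]
  refine (norm_integral_le_of_norm_le (g := fun x => |f x - g x|) ?_ (ae_of_all _ fun x => ?_)).trans
    (integral_abs_sub_le_norm_sub f g)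
  · exact (((Lp.memLp f).integrable (by norm_num)).sub
      ((Lp.memLp g).integrable (by norm_num))).abs
  · have : exp ((f x : ℝ) * I) - exp ((g x : ℝ) * I)
        = exp ((g x : ℝ) * I) * (exp (I * ((f x - g x : ℝ) : ℂ)) - 1) := by
      rw [mul_sub, ← Complex.exp_add]
      push_cast
      ring_nf
    rw [this, norm_mul, norm_exp_ofReal_mul_I, one_mul]
    exact Real.norm_exp_I_mul_ofReal_sub_one_le

theorem coeFn_sum_smul_Lp {κ : Type*} (F : Finset κ) (t : κ → ℝ) (f : κ → Lp ℝ 2 P) :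
    ⇑(∑ i ∈ F, t i • f i) =ᵐ[P] fun x => ∑ i ∈ F, t i * f i x := by
  classical
  induction F using Finset.induction_on with
  | empty =>
    simp only [Finset.sum_empty]
    exact Lp.coeFn_zero ℝ 2 P
  | insert i F hi ih =>
    rw [Finset.sum_insert hi]
    filter_upwards [Lp.coeFn_add (t i • f i) (∑ i ∈ F, t i • f i), ih, Lp.coeFn_smul (t i) (f i)]
      with x h1 h2 h3
    rw [h1, Pi.add_apply, h2, h3, Finset.sum_insert hi, Pi.smul_apply, smul_eq_mul]

end Lp

namespace gaussianPi

variable {ι : Type*} {H : Type*} [NormedAddCommGroup H] [InnerProductSpace ℝ H]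

theorem memLp_eval (i : ι) : MemLp (fun x : ι → ℝ => x i) 2 (gaussianPi ι) :=
  (memLp_id_gaussianReal' 2 (by norm_num)).comp_measurePreserving
    (measurePreserving_eval_infinitePi (fun _ : ι => gaussianReal 0 1) i)

theorem orthonormal_eval : Orthonormal ℝ fun i : ι => (memLp_eval i).toLp := by
  classical
  rw [orthonormal_iff_ite]
  intro i j
  have hL : inner ℝ ((memLp_eval i).toLp) ((memLp_eval j).toLp)
      = ∫ x, x j * x i ∂gaussianPi ι := by
    rw [L2.inner_def]
    refine integral_congr_ae ?_
    filter_upwards [(memLp_eval i).coeFn_toLp, (memLp_eval j).coeFn_toLp] with x h1 h2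
    rw [h1, h2]
    rfl
  rw [hL]
  split_ifs with hij
  · subst hij
    have h1 := integral_map (μ := gaussianPi ι) (φ := fun x => x i) (f := fun y : ℝ => y ^ 2)
      (measurable_pi_apply i).aemeasurable (by fun_prop)
    rw [gaussianPi, Measure.infinitePi_map_eval, ← variance_of_integral_eq_zero (by fun_prop)
      integral_id_gaussianReal, variance_fun_id_gaussianReal] at h1
    simpa [sq, gaussianPi] using h1.symm
  · have h1 := integral_map (μ := gaussianPi ι) (φ := fun x => (x i, x j))
      (f := fun p : ℝ × ℝ => p.2 * p.1) (by fun_prop) (Continuous.aestronglyMeasurable (by fun_prop))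
    rw [gaussianPi, Measure.infinitePi_map_eval_prod hij] at h1
    simp only [mul_comm (Prod.snd _)] at h1
    rw [integral_prod_mul (fun x : ℝ => x) (fun x : ℝ => x), integral_id_gaussianReal] at h1
    simpa [gaussianPi, mul_comm] using h1.symm

/-- The isonormal Gaussian process on a Hilbert space with Hilbert basis `b`, normalised by
`b i ↦ (x ↦ x i)`. -/
noncomputable def isonormal (b : HilbertBasis ι ℝ H) : H →ₗᵢ[ℝ] Lp ℝ 2 (gaussianPi ι) :=
  (orthonormal_eval (ι := ι)).orthogonalFamily.linearIsometry.comp b.repr.toLinearIsometry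

variable (b : HilbertBasis ι ℝ H)

theorem isonormal_basis (i : ι) : isonormal b (b i) = (memLp_eval i).toLp := by
  classical
  change (orthonormal_eval (ι := ι)).orthogonalFamily.linearIsometry (b.repr (b i)) = _
  rw [b.repr_self, OrthogonalFamily.linearIsometry_apply_single]
  simp

theorem coeFn_isonormal_basis (i : ι) : isonormal b (b i) =ᵐ[gaussianPi ι] fun x => x i := by
  rw [isonormal_basis]
  exact (memLp_eval i).coeFn_toLp

open Complex in
-- Both sides are continuous in `h` and agree on the span of the basis, which is dense.
theorem integral_exp_isonormal (h : H) :
    ∫ x, exp ((isonormal b h x : ℝ) * I) ∂gaussianPi ι = exp ((-‖h‖ ^ 2 / 2 : ℝ)) := by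
  have hcl : IsClosed {h : H | ∫ x, exp ((isonormal b h x : ℝ) * I) ∂gaussianPi ι
      = exp ((-‖h‖ ^ 2 / 2 : ℝ))} :=
    isClosed_eq (continuous_integral_exp_Lp.comp (isonormal b).continuous) (by fun_prop)
  have hsub : (Submodule.span ℝ (Set.range b) : Set H) ⊆ {h : H |
      ∫ x, exp ((isonormal b h x : ℝ) * I) ∂gaussianPi ι = exp ((-‖h‖ ^ 2 / 2 : ℝ))} := by
    intro h hh
    obtain ⟨t, rfl⟩ := (Finsupp.mem_span_range_iff_exists_finsupp).1 hh
    simp only [Finsupp.sum, mem_ofPred_eq]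
    have h1 : ⇑(isonormal b (∑ i ∈ t.support, t i • b i)) =ᵐ[gaussianPi ι]
        fun x => ∑ i ∈ t.support, t i * x i := by
      simp only [map_sum, map_smul]
      refine (coeFn_sum_smul_Lp t.support t fun i => isonormal b (b i)).trans ?_
      have : ∀ᵐ x ∂gaussianPi ι, ∀ i ∈ t.support, isonormal b (b i) x = x i :=
        (ae_ball_iff t.support.countable_toSet).2 fun i _ => coeFn_isonormal_basis b i
      filter_upwards [this] with x hx
      exact Finset.sum_congr rfl fun i hi => by rw [hx i hi]
    have h2 : ∫ x, exp ((isonormal b (∑ i ∈ t.support, t i • b i) x : ℝ) * I) ∂gaussianPi ι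
        = ∫ x, exp ((∑ i ∈ t.support, t i * x i : ℝ) * I) ∂gaussianPi ι :=
      integral_congr_ae (h1.mono fun x hx => by simp only [hx])
    rw [h2, integral_exp_sum, ← real_inner_self_eq_norm_sq, b.orthonormal.inner_sum]
    simp [sq]
  have := hcl.closure_subset_iff.2 hsub
  rw [← Submodule.topologicalClosure_coe, b.dense_span] at this
  exact this trivial

end gaussianPi

/-! ### Transformations of Gaussian space induced by isometries. -/

namespace gaussianPi

variable {ι : Type*} {H : Type*} [NormedAddCommGroup H] [InnerProductSpace ℝ H]
  (b : HilbertBasis ι ℝ H)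

/-- The transformation of the Gaussian space induced by an isometry of the Hilbert space. -/
noncomputable def rotate (U : H →ₗᵢ[ℝ] H) (x : ι → ℝ) : ι → ℝ :=
  fun i => isonormal b (U (b i)) x

theorem measurable_rotate (U : H →ₗᵢ[ℝ] H) : Measurable (rotate b U) :=
  measurable_pi_iff.2 fun _ => (Lp.stronglyMeasurable _).measurable

theorem coeFn_isonormal_sum (F : Finset ι) (t : ι → ℝ) (h : ι → H) :
    isonormal b (∑ i ∈ F, t i • h i) =ᵐ[gaussianPi ι]
      fun x => ∑ i ∈ F, t i * isonormal b (h i) x := by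
  simp only [map_sum, map_smul]
  exact coeFn_sum_smul_Lp F t fun i => isonormal b (h i)

open Complex in
/-- The joint characteristic function of the coordinates of `x` and `rotate b U x`. -/
theorem integral_exp_rotate (U : H →ₗᵢ[ℝ] H) (F : Finset ι) (t r : ι → ℝ) :
    ∫ x, exp ((∑ i ∈ F, t i * x i + ∑ i ∈ F, r i * rotate b U x i : ℝ) * I) ∂gaussianPi ι
      = exp ((-‖∑ i ∈ F, t i • b i + U (∑ i ∈ F, r i • b i)‖ ^ 2 / 2 : ℝ)) := by
  rw [← integral_exp_isonormal b]
  refine integral_congr_ae ?_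
  have h1 : ∀ᵐ x ∂gaussianPi ι, ∀ i ∈ F, isonormal b (b i) x = x i :=
    (ae_ball_iff F.countable_toSet).2 fun i _ => coeFn_isonormal_basis b i
  rw [map_sum U]
  simp only [map_smul]
  rw [map_add (isonormal b)]
  filter_upwards [h1, coeFn_isonormal_sum b F t fun i => b i,
    coeFn_isonormal_sum b F r fun i => U (b i),
    Lp.coeFn_add (isonormal b (∑ i ∈ F, t i • b i)) (isonormal b (∑ i ∈ F, r i • U (b i)))]
    with x h1 h2 h3 h4
  rw [h4, Pi.add_apply, h2, h3, Finset.sum_congr rfl fun i hi => by rw [← h1 i hi]]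
  rfl

theorem norm_sum_smul_sq (F : Finset ι) (r : ι → ℝ) :
    ‖∑ i ∈ F, r i • b i‖ ^ 2 = ∑ i ∈ F, r i ^ 2 := by
  rw [← real_inner_self_eq_norm_sq, b.orthonormal.inner_sum]
  simp [sq]

theorem measurePreserving_rotate (U : H →ₗᵢ[ℝ] H) :
    MeasurePreserving (rotate b U) (gaussianPi ι) (gaussianPi ι) := by
  refine ⟨measurable_rotate b U, map_eq_of_integral_exp_sum (measurable_rotate b U) fun F t => ?_⟩
  have := integral_exp_rotate b U F 0 t
  simpa [-map_sum, norm_sum_smul_sq, U.norm_map] using this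

/-- Both sides are linear isometries of `h` into `L²`, and on basis vectors they agree by the
definition of `rotate`. -/
theorem isonormal_comp_rotate (U : H →ₗᵢ[ℝ] H) (h : H) :
    (fun x => isonormal b h (rotate b U x)) =ᵐ[gaussianPi ι] isonormal b (U h) := by
  have hU := measurePreserving_rotate b U
  let L : H →ₗᵢ[ℝ] Lp ℝ 2 (gaussianPi ι) :=
    (Lp.compMeasurePreservingₗᵢ ℝ (rotate b U) hU).comp (isonormal b)
  have hL : L.toContinuousLinearMap = ((isonormal b).comp U).toContinuousLinearMap := by
    refine ContinuousLinearMap.ext_on (s := Set.range b) ?_ ?_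
    · rw [dense_iff_closure_eq, ← Submodule.topologicalClosure_coe, b.dense_span]
      rfl
    · rintro _ ⟨i, rfl⟩
      change Lp.compMeasurePreserving (rotate b U) hU (isonormal b (b i)) = isonormal b (U (b i))
      refine Lp.ext ((Lp.coeFn_compMeasurePreserving _ hU).trans ?_)
      exact hU.quasiMeasurePreserving.ae_eq_comp (coeFn_isonormal_basis b i)
  have h1 : Lp.compMeasurePreserving (rotate b U) hU (isonormal b h) = isonormal b (U h) :=
    DFunLike.congr_fun hL h
  rw [← h1]
  exact (Lp.coeFn_compMeasurePreserving _ hU).symm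

/-- The order of composition is reversed. Equality is only almost everywhere, since the coordinates
of `rotate` are chosen representatives of `L²` classes. -/
theorem rotate_comp [Countable ι] (U V : H →ₗᵢ[ℝ] H) :
    (fun x => rotate b U (rotate b V x)) =ᵐ[gaussianPi ι] rotate b (V.comp U) := by
  have : ∀ᵐ x ∂gaussianPi ι, ∀ i, rotate b U (rotate b V x) i = rotate b (V.comp U) x i :=
    ae_all_iff.2 fun i => isonormal_comp_rotate b V (U (b i))
  exact this.mono fun x hx => funext hx

theorem rotate_id [Countable ι] :
    rotate b LinearIsometry.id =ᵐ[gaussianPi ι] fun x => x := by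
  have : ∀ᵐ x ∂gaussianPi ι, ∀ i, rotate b LinearIsometry.id x i = x i :=
    ae_all_iff.2 fun i => coeFn_isonormal_basis b i
  exact this.mono fun x hx => funext hx

/-- If `U` acts on finitely many basis vectors, up to orthogonal directions, as multiplication by
`c`, then it moves the corresponding coordinates as an Ornstein-Uhlenbeck kernel. -/
theorem measure_setOf_restrict_rotate {c s : ℝ} (hcs : c ^ 2 + s ^ 2 = 1) (F : Finset ι)
    [DecidableEq ι] (U : H →ₗᵢ[ℝ] H)
    (hU : ∀ i ∈ F, ∀ j ∈ F, inner ℝ (b i) (U (b j)) = if i = j then c else 0)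
    {A B : Set (F → ℝ)} (hA : MeasurableSet A) (hB : MeasurableSet B) :
    gaussianPi ι {x | F.restrict x ∈ A ∧ F.restrict (rotate b U x) ∈ B}
      = (gaussianPi ι).prod (gaussianPi ι)
        {p | F.restrict p.1 ∈ A ∧ F.restrict (c • p.1 + s • p.2) ∈ B} := by
  have hUm := measurable_rotate b U
  let Y : (ι → ℝ) → F ⊕ F → ℝ := fun x => Sum.elim (F.restrict x) (F.restrict (rotate b U x))
  let Z : (ι → ℝ) × (ι → ℝ) → F ⊕ F → ℝ :=
    fun p => Sum.elim (F.restrict p.1) (F.restrict (c • p.1 + s • p.2))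
  have hY : Measurable Y := by
    refine measurable_pi_iff.2 ?_
    rintro (i | i)
    · exact measurable_pi_apply _
    · exact (measurable_pi_apply i.1).comp hUm
  have hZ : Measurable Z := by
    refine measurable_pi_iff.2 ?_
    rintro (i | i)
    · exact (measurable_pi_apply i.1).comp measurable_fst
    · change Measurable fun p : (ι → ℝ) × (ι → ℝ) => (c • p.1 + s • p.2) i
      fun_prop
  -- Both characteristic functions are Gaussian; since `U` is isometric, only the cross covariance
  -- needs comparison, and it is prescribed by `hU`.
  have key : (gaussianPi ι).map Y = ((gaussianPi ι).prod (gaussianPi ι)).map Z := by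
    refine map_eq_map_of_integral_exp_eq hY hZ fun u => ?_
    set t : ι → ℝ := fun i => if hi : i ∈ F then u (.inl ⟨i, hi⟩) else 0 with ht
    set r : ι → ℝ := fun i => if hi : i ∈ F then u (.inr ⟨i, hi⟩) else 0 with hr
    have hsum (v w : ι → ℝ) :
        ∑ i, u i * (Sum.elim (F.restrict v) (F.restrict w) : F ⊕ F → ℝ) i
          = ∑ i ∈ F, t i * v i + ∑ i ∈ F, r i * w i := by
      rw [Fintype.sum_sum_type, ← Finset.sum_coe_sort F, ← Finset.sum_coe_sort F]
      simp [ht, hr]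
    simp only [Y, Z, hsum]
    rw [integral_exp_rotate, integral_exp_sum_rotation F t r c s hcs]
    congr 4
    have hinner : inner ℝ (∑ i ∈ F, t i • b i) (U (∑ i ∈ F, r i • b i))
        = c * ∑ i ∈ F, t i * r i := by
      rw [map_sum, sum_inner, Finset.mul_sum]
      refine Finset.sum_congr rfl fun i hi => ?_
      rw [inner_sum, Finset.sum_eq_single_of_mem i hi]
      · rw [map_smul, real_inner_smul_left, real_inner_smul_right, hU i hi i hi, if_pos rfl]
        ring
      · intro j hj hji
        rw [map_smul, real_inner_smul_left, real_inner_smul_right, hU i hi j hj, if_neg hji.symm]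
        ring
    rw [norm_add_sq_real, hinner, U.norm_map, norm_sum_smul_sq, norm_sum_smul_sq]
  have hS : MeasurableSet {v : F ⊕ F → ℝ | (fun i => v (.inl i)) ∈ A ∧ (fun i => v (.inr i)) ∈ B} :=
    ((by fun_prop : Measurable fun (v : F ⊕ F → ℝ) i => v (.inl i)) hA).inter
      ((by fun_prop : Measurable fun (v : F ⊕ F → ℝ) i => v (.inr i)) hB)
  have := congrArg (fun m => m {v : F ⊕ F → ℝ | (fun i => v (.inl i)) ∈ A ∧
    (fun i => v (.inr i)) ∈ B}) key
  simp only [Measure.map_apply hY hS, Measure.map_apply hZ hS] at this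
  exact this

theorem exists_finset_restrict_preimage {A : Set (ι → ℝ)} (hA : MeasurableSet A)
    {ε : ℝ} (hε : 0 < ε) :
    ∃ (F : Finset ι) (S : Set (F → ℝ)), MeasurableSet S ∧
      (gaussianPi ι).real (A ∆ (F.restrict ⁻¹' S)) < ε := by
  obtain ⟨t, ht, h⟩ := (Measure.MeasureDense.of_generateFrom_isSetAlgebra_finite
    (μ := gaussianPi ι) isSetAlgebra_measurableCylinders
      generateFrom_measurableCylinders.symm).approx A hA (measure_ne_top _ _) ε hε
  obtain ⟨F, S, hS, rfl⟩ := (mem_measurableCylinders _).1 ht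
  exact ⟨F, S, hS, (ENNReal.lt_ofReal_iff_toReal_lt (measure_ne_top _ _)).1 h⟩

/-- Sets of positive measure are moved onto each other by every isometry that acts on finitely many
basis vectors as multiplication by `c`, up to orthogonal directions. -/
theorem exists_finset_forall_measure_inter_pos [Countable ι] [DecidableEq ι] {c s : ℝ}
    (hcs : c ^ 2 + s ^ 2 = 1) (hs : s ≠ 0) {A B : Set (ι → ℝ)} (hA : MeasurableSet A)
    (hB : MeasurableSet B) (hA0 : gaussianPi ι A ≠ 0) (hB0 : gaussianPi ι B ≠ 0) :
    ∃ F : Finset ι, ∀ U : H →ₗᵢ[ℝ] H,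
      (∀ i ∈ F, ∀ j ∈ F, inner ℝ (b i) (U (b j)) = if i = j then c else 0) →
        0 < (gaussianPi ι).real (A ∩ rotate b U ⁻¹' B) := by
  set γ := gaussianPi ι
  set R : (ι → ℝ) × (ι → ℝ) → ι → ℝ := fun p => c • p.1 + s • p.2 with hR
  have hRm : Measurable R := by fun_prop
  have hmp : MeasurePreserving R (γ.prod γ) γ := ⟨hRm, map_rotation hcs⟩
  have hpos := measure_setOf_add_mem_pos hs (map_rotation hcs) hA hB hA0 hB0
  set p := (γ.prod γ).real (Prod.fst ⁻¹' A ∩ R ⁻¹' B) with hp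
  have hp0 : 0 < p := ENNReal.toReal_pos hpos (measure_ne_top _ _)
  -- Both sets are replaced by cylinders, once for the kernel and once for `U`. The four errors,
  -- each below `p / 4`, total less than `p`. The cylinders, hence `F₁ ∪ F₂`, are chosen before `U`.
  obtain ⟨F₁, S₁, hS₁, h₁⟩ := exists_finset_restrict_preimage hA (ε := p / 4) (by positivity)
  obtain ⟨F₂, S₂, hS₂, h₂⟩ := exists_finset_restrict_preimage hB (ε := p / 4) (by positivity)
  refine ⟨F₁ ∪ F₂, fun U hU => ?_⟩
  have hUm := measurePreserving_rotate b U
  set A' : Set (ι → ℝ) := F₁.restrict ⁻¹' S₁ with hA'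
  set B' : Set (ι → ℝ) := F₂.restrict ⁻¹' S₂ with hB'
  have hA'm : MeasurableSet A' := (Finset.measurable_restrict F₁) hS₁
  have hB'm : MeasurableSet B' := (Finset.measurable_restrict F₂) hS₂
  have heq : γ.real (A' ∩ rotate b U ⁻¹' B') = (γ.prod γ).real (Prod.fst ⁻¹' A' ∩ R ⁻¹' B') := by
    have := measure_setOf_restrict_rotate b hcs (F₁ ∪ F₂) U hU
      (A := Finset.restrict₂ (π := fun _ => ℝ) (Finset.subset_union_left : F₁ ⊆ F₁ ∪ F₂) ⁻¹' S₁)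
      (B := Finset.restrict₂ (π := fun _ => ℝ) (Finset.subset_union_right : F₂ ⊆ F₁ ∪ F₂) ⁻¹' S₂)
      (Finset.measurable_restrict₂ _ hS₁) (Finset.measurable_restrict₂ _ hS₂)
    exact congrArg ENNReal.toReal this
  have hle1 : (γ.prod γ).real (Prod.fst ⁻¹' A ∩ R ⁻¹' B)
      ≤ (γ.prod γ).real (Prod.fst ⁻¹' A' ∩ R ⁻¹' B') + γ.real (A ∆ A') + γ.real (B ∆ B') := by
    have e1 : γ.real (A ∆ A') = (γ.prod γ).real (Prod.fst ⁻¹' (A ∆ A')) :=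
      (measurePreserving_fst.measureReal_preimage (hA.symmDiff hA'm).nullMeasurableSet).symm
    have e2 : γ.real (B ∆ B') = (γ.prod γ).real (R ⁻¹' (B ∆ B')) :=
      (hmp.measureReal_preimage (hB.symmDiff hB'm).nullMeasurableSet).symm
    rw [e1, e2]
    refine (measureReal_mono (?_ : _ ⊆ (Prod.fst ⁻¹' A' ∩ R ⁻¹' B') ∪ Prod.fst ⁻¹' (A ∆ A')
      ∪ R ⁻¹' (B ∆ B'))).trans ((measureReal_union_le _ _).trans ?_)
    · rintro q ⟨hqA, hqB⟩
      simp only [mem_preimage, mem_union, mem_inter_iff, mem_symmDiff] at hqA hqB ⊢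
      tauto
    · gcongr
      exact measureReal_union_le _ _
  have hle2 : γ.real (A' ∩ rotate b U ⁻¹' B')
      ≤ γ.real (A ∩ rotate b U ⁻¹' B) + γ.real (A ∆ A') + γ.real (B ∆ B') := by
    have e2 : γ.real (B ∆ B') = γ.real (rotate b U ⁻¹' (B ∆ B')) :=
      (hUm.measureReal_preimage (hB.symmDiff hB'm).nullMeasurableSet).symm
    rw [e2]
    refine (measureReal_mono (?_ : _ ⊆ (A ∩ rotate b U ⁻¹' B) ∪ (A ∆ A')
      ∪ rotate b U ⁻¹' (B ∆ B'))).trans ((measureReal_union_le _ _).trans ?_)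
    · rintro q ⟨hqA, hqB⟩
      simp only [mem_preimage, mem_union, mem_inter_iff, mem_symmDiff] at hqA hqB ⊢
      tauto
    · gcongr
      exact measureReal_union_le _ _
  linarith

end gaussianPi

/-! ### Convergence of transformations on the measure algebra -/

section SymmDiff

variable {X α : Type*} [mX : MeasurableSpace X]

/-- The `σ`-algebra of measurable sets `s` for which `μ ((T a)⁻¹ s ∆ s)` tends to zero. -/
abbrev symmDiffTendstoZero (μ : Measure X) [IsFiniteMeasure μ] (l : Filter α) (T : α → X → X)
    (hT : ∀ a, MeasurePreserving (T a) μ μ) : MeasurableSpace X where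
  MeasurableSet' s := MeasurableSet s ∧ Tendsto (fun a => μ ((T a ⁻¹' s) ∆ s)) l (𝓝 0)
  measurableSet_empty := ⟨.empty, by simpa using tendsto_const_nhds⟩
  measurableSet_compl s hs := ⟨hs.1.compl, by simpa [compl_symmDiff_compl] using hs.2⟩
  measurableSet_iUnion f hf := by
    refine ⟨.iUnion fun n => (hf n).1, ?_⟩
    -- The part of the union missed by the sets of index at most `N`, whence the later `range (N +
    -- 1)`. Its preimage under `T a` has the same measure, so one `N` controls this error for all
    -- `a`.
    set D : ℕ → Set X := fun N => (⋃ n, f n) \ Set.accumulate f N with hD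
    have hDm (N : ℕ) : MeasurableSet (D N) :=
      (MeasurableSet.iUnion fun n => (hf n).1).diff
        (MeasurableSet.biUnion (Set.to_countable _) fun n _ => (hf n).1)
    have hlim : Tendsto (μ ∘ D) atTop (𝓝 0) := by
      have h0 : ⋂ N, D N = ∅ := by
        rw [hD, ← sdiff_iUnion, iUnion_accumulate, sdiff_self]
      have := tendsto_measure_iInter_atTop (μ := μ) (fun N => (hDm N).nullMeasurableSet)
        (fun m n hmn => sdiff_subset_sdiff_right (monotone_accumulate hmn)) ⟨0, measure_ne_top _ _⟩
      rwa [h0, measure_empty] at this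
    rw [ENNReal.tendsto_nhds_zero]
    intro ε hε
    have hε3 : 0 < ε / 3 := ENNReal.div_pos hε.ne' (by norm_num)
    obtain ⟨N, hN⟩ := (ENNReal.tendsto_nhds_zero.1 hlim _ hε3).exists
    have hsum : Tendsto (fun a => ∑ n ∈ Finset.range (N + 1), μ ((T a ⁻¹' f n) ∆ f n)) l (𝓝 0) := by
      have := tendsto_finsetSum (Finset.range (N + 1)) fun n _ => (hf n).2
      simpa using this
    filter_upwards [ENNReal.tendsto_nhds_zero.1 hsum _ hε3] with a ha
    have hsub : (T a ⁻¹' ⋃ n, f n) ∆ (⋃ n, f n)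
        ⊆ (⋃ n ∈ Finset.range (N + 1), (T a ⁻¹' f n) ∆ f n) ∪ T a ⁻¹' D N ∪ D N := by
      intro x hx
      by_contra hcon
      simp only [mem_union, not_or, mem_iUnion, not_exists, mem_symmDiff, mem_preimage, hD,
        Set.mem_sdiff, Set.mem_accumulate, Finset.mem_range, not_and, not_not] at hx hcon
      obtain ⟨⟨h1, h2⟩, h3⟩ := hcon
      rcases hx with ⟨⟨m, hm⟩, hx⟩ | ⟨⟨m, hm⟩, hx⟩
      · exact h2 ⟨m, hm⟩ fun n hn hxn => hx n ((h1 n (by omega)).1 hxn)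
      · exact h3 ⟨m, hm⟩ fun n hn hxn => hx n ((h1 n (by omega)).2 hxn)
    calc μ ((T a ⁻¹' ⋃ n, f n) ∆ (⋃ n, f n))
        ≤ μ (⋃ n ∈ Finset.range (N + 1), (T a ⁻¹' f n) ∆ f n) + μ (T a ⁻¹' D N) + μ (D N) :=
          (measure_mono hsub).trans ((measure_union_le _ _).trans
            (add_le_add_left (measure_union_le _ _) _))
      _ ≤ ε / 3 + ε / 3 + ε / 3 := by
          rw [(hT a).measure_preimage (hDm N).nullMeasurableSet]
          gcongr
          · exact (measure_biUnion_finset_le _ _).trans ha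
          · exact hN
          · exact hN
      _ = ε := ENNReal.add_thirds ε

end SymmDiff

namespace gaussianPi

variable {ι α : Type*} {H : Type*} [NormedAddCommGroup H] [InnerProductSpace ℝ H]
  (b : HilbertBasis ι ℝ H)

/-- If `U a` converges strongly to the identity, then so do the induced automorphisms of the measure
algebra. -/
theorem tendsto_measure_rotate_symmDiff {l : Filter α} {U : α → H →ₗᵢ[ℝ] H}
    (hU : ∀ h, Tendsto (fun a => U a h) l (𝓝 h)) {s : Set (ι → ℝ)} (hs : MeasurableSet s) :
    Tendsto (fun a => gaussianPi ι ((rotate b (U a) ⁻¹' s) ∆ s)) l (𝓝 0) := by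
  -- The good sets form a `σ`-algebra, so half-spaces `{x | x i ≤ r}` suffice.
  suffices hle : MeasurableSpace.pi ≤ symmDiffTendstoZero (gaussianPi ι) l
    (fun a => rotate b (U a)) fun a => measurePreserving_rotate b (U a) from (hle s hs).2
  refine iSup_le fun i => Measurable.comap_le ?_
  refine @measurable_of_Iic ℝ _ _ _ _ (symmDiffTendstoZero _ _ _ _) _ _ _ _ fun r => ?_
  have hr : MeasurableSet ((fun x : ι → ℝ => x i) ⁻¹' Iic r) := measurable_pi_apply i measurableSet_Iic
  refine ⟨hr, ?_⟩
  rw [ENNReal.tendsto_nhds_zero]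
  intro ε hε
  have hε2 : 0 < ε / 2 := ENNReal.half_pos hε.ne'
  obtain ⟨V, hrV, hV, hVε⟩ := Set.exists_isOpen_lt_of_lt (μ := gaussianReal 0 1) {r} (ε / 2)
    (by
      have : NullSingletonClass (gaussianReal 0 1) := nullSingletonClass_gaussianReal one_ne_zero
      rwa [measure_singleton])
  obtain ⟨η, hη, hball⟩ := Metric.isOpen_iff.1 hV r (hrV rfl)
  have htend : Tendsto (fun a => isonormal b (U a (b i))) l (𝓝 (isonormal b (b i))) :=
    ((isonormal b).continuous.tendsto _).comp (hU (b i))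
  have hmeas := tendstoInMeasure_of_tendsto_Lp htend (ENNReal.ofReal η) (by simpa using hη)
  filter_upwards [ENNReal.tendsto_nhds_zero.1 hmeas _ hε2] with a ha
  -- A point can cross the threshold `r` only if its coordinate lies within `η` of `r`, hence in
  -- `V`, or is moved by at least `η`. The second event is rare by convergence in measure.
  have hsub : ∀ᵐ x ∂gaussianPi ι,
      x ∈ (rotate b (U a) ⁻¹' ((fun x : ι → ℝ => x i) ⁻¹' Iic r)) ∆ ((fun x : ι → ℝ => x i) ⁻¹' Iic r)
      → x ∈ ((fun x : ι → ℝ => x i) ⁻¹' V) ∪ {x | ENNReal.ofReal η ≤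
          edist (isonormal b (U a (b i)) x) (isonormal b (b i) x)} := by
    filter_upwards [coeFn_isonormal_basis b i] with x hx hxm
    simp only [mem_union, mem_preimage, mem_ofPred_eq, hx, mem_symmDiff, mem_Iic, rotate] at hxm ⊢
    by_contra hcon
    rw [not_or, not_le, edist_dist, ENNReal.ofReal_lt_ofReal_iff hη, Real.dist_eq, abs_lt] at hcon
    have hnb : x i ∉ Metric.ball r η := fun h => hcon.1 (hball h)
    rw [Metric.mem_ball, Real.dist_eq, not_lt, le_abs] at hnb
    rcases hxm with ⟨h1, h2⟩ | ⟨h1, h2⟩ <;> rcases hnb with h3 | h3 <;> linarith [hcon.2.1, hcon.2.2]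
  have hVm : gaussianPi ι ((fun x : ι → ℝ => x i) ⁻¹' V) = gaussianReal 0 1 V :=
    (measurePreserving_eval_infinitePi (fun _ : ι => gaussianReal 0 1) i).measure_preimage
      hV.measurableSet.nullMeasurableSet
  calc _ ≤ _ := measure_mono_ae hsub
    _ ≤ _ := measure_union_le _ _
    _ ≤ ε / 2 + ε / 2 := by
        rw [hVm]
        exact add_le_add hVε.le ha
    _ = ε := ENNReal.add_halves ε

end gaussianPi

/-! ### Boolean actions from near-actions -/

namespace MeasureAlgebra

variable {X : Type*} [MeasurableSpace X] {μ : Measure X}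

/-- The map induced on the measure algebra by a quasi-measure-preserving transformation. -/
def preimage (T : X → X) (hT : Measure.QuasiMeasurePreserving T μ μ) :
    MeasureAlgebra μ → MeasureAlgebra μ :=
  Quotient.map (fun s => ⟨T ⁻¹' s.1, hT.measurable s.2⟩) fun _ _ h => hT.preimage_ae_eq h

theorem preimage_mono (T : X → X) (hT : Measure.QuasiMeasurePreserving T μ μ) :
    Monotone (preimage T hT) := by
  intro a b
  induction a using ind; induction b using ind
  exact fun h => hT.ae h

theorem measure_mono [IsFiniteMeasure μ] {a b : MeasureAlgebra μ} (h : a ≤ b) :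
    a.measure ≤ b.measure := by
  induction a using ind; induction b using ind
  exact ENNReal.toReal_mono (measure_ne_top _ _) (measure_mono_ae h)

theorem measure_mk_pos_iff [IsFiniteMeasure μ] {s : Set X} (hs : MeasurableSet s) :
    0 < (mk μ s hs).measure ↔ μ s ≠ 0 := by
  rw [measure_mk, measureReal_def, ENNReal.toReal_pos_iff, pos_iff_ne_zero]
  simp [measure_lt_top]

theorem measure_bot : (⊥ : MeasureAlgebra μ).measure = 0 :=
  measureReal_empty

theorem measure_pos [IsFiniteMeasure μ] {a : MeasureAlgebra μ} (h : a ≠ ⊥) : 0 < a.measure := by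
  induction a using ind with
  | h s hs => exact (measure_mk_pos_iff hs).2 fun h0 => h (mk_eq_mk.2 (ae_eq_empty.2 h0))

instance separableSpace [IsProbabilityMeasure μ] [IsSeparable μ] :
    TopologicalSpace.SeparableSpace (MeasureAlgebra μ) := by
  obtain ⟨𝒜, hc, hd⟩ := exists_countable_measureDense (μ := μ)
  have : Countable 𝒜 := hc
  refine ⟨Set.range fun s : 𝒜 => mk μ s (hd.measurable s s.2), countable_range _, ?_⟩
  rw [Metric.dense_iff]
  intro a ε hε
  induction a using ind with
  | h s hs =>
    obtain ⟨t, ht, hst⟩ := hd.approx s hs (measure_ne_top _ _) ε hε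
    refine ⟨_, ?_, ⟨⟨t, ht⟩, rfl⟩⟩
    rw [Metric.mem_ball, dist_comm, dist_def, mk_symmDiff_mk, measure_mk]
    exact (ENNReal.lt_ofReal_iff_toReal_lt (measure_ne_top _ _)).1 hst

end MeasureAlgebra

namespace BooleanAction

open MeasureAlgebra

variable {G X : Type*} [CommGroup G] [TopologicalSpace G] [MeasurableSpace X]
  {μ : Measure X} [IsProbabilityMeasure μ]

/-- The Boolean action induced by a near-action of a commutative topological group by
measure-preserving transformations. -/
def ofNearAction [IsTopologicalGroup G] (T : G → X → X) (hT : ∀ g, MeasurePreserving (T g) μ μ)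
    (h_one : T 1 =ᵐ[μ] fun x => x) (h_mul : ∀ g h, (fun x => T g (T h x)) =ᵐ[μ] T (g * h))
    (h_cont : ∀ s, MeasurableSet s → Tendsto (fun g => μ ((T g ⁻¹' s) ∆ s)) (𝓝 1) (𝓝 0)) :
    BooleanAction G μ := by
  have hp_one (a : MeasureAlgebra μ) : preimage (T 1) (hT 1).quasiMeasurePreserving a = a := by
    induction a using ind with
    | h s hs =>
      refine mk_eq_mk.2 ?_
      filter_upwards [h_one] with x hx
      exact congrArg (fun y => s y) hx
  have hp_mul (g h : G) (a : MeasureAlgebra μ) :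
      preimage (T g) (hT g).quasiMeasurePreserving
        (preimage (T h) (hT h).quasiMeasurePreserving a)
        = preimage (T (g * h)) (hT (g * h)).quasiMeasurePreserving a := by
    induction a using ind with
    | h s hs =>
      refine mk_eq_mk.2 ?_
      -- Preimages reverse the order of composition; commutativity of `G` restores a homomorphism.
      filter_upwards [h_mul h g] with x hx
      rw [mul_comm g h]
      exact congrArg (fun y => s y) hx
  let e (g : G) : MeasureAlgebra μ ≃o MeasureAlgebra μ :=
    { toFun := preimage (T g) (hT g).quasiMeasurePreserving
      invFun := preimage (T g⁻¹) (hT g⁻¹).quasiMeasurePreserving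
      left_inv := fun a => by
        rw [hp_mul]
        simp only [inv_mul_cancel, hp_one]
      right_inv := fun a => by
        rw [hp_mul]
        simp only [mul_inv_cancel, hp_one]
      map_rel_iff' := fun {a c} => by
        refine ⟨fun h => ?_, fun h => preimage_mono (T g) (hT g).quasiMeasurePreserving h⟩
        have := preimage_mono (T g⁻¹) (hT g⁻¹).quasiMeasurePreserving h
        simpa only [Equiv.coe_fn_mk, hp_mul, inv_mul_cancel, hp_one] using this }
  have he (g : G) (a : MeasureAlgebra μ) : (e g a).measure = a.measure := by
    induction a using ind with
    | h s hs => exact (hT g).measureReal_preimage hs.nullMeasurableSet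
  let φ : G →* MeasureAlgebra.Aut μ :=
    { toFun := fun g => ⟨e g, he g⟩
      map_one' := Subtype.ext (OrderIso.ext (funext hp_one))
      map_mul' := fun g h => Subtype.ext (OrderIso.ext (funext fun a => (hp_mul g h a).symm)) }
  refine ⟨φ, continuous_induced_rng.2 (continuous_pi fun a => ?_)⟩
  rw [continuous_iff_continuousAt]
  intro g₀
  have hdist (g : G) : dist (e g a) (e g₀ a) = dist (e (g₀⁻¹ * g) a) a := by
    have h1 : e g a = e g₀ (e (g₀⁻¹ * g) a) := by
      have := hp_mul g₀ (g₀⁻¹ * g) a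
      simp only [mul_inv_cancel_left] at this
      exact this.symm
    rw [h1, dist_def, dist_def, ← map_symmDiff', he]
  have hlim : Tendsto (fun g => dist (e (g₀⁻¹ * g) a) a) (𝓝 g₀) (𝓝 0) := by
    have h1 : Tendsto (fun g => g₀⁻¹ * g) (𝓝 g₀) (𝓝 1) := by
      have : ContinuousAt (fun g => g₀⁻¹ * g) g₀ := by fun_prop
      simpa [ContinuousAt] using this
    have h2 : Tendsto (fun g => dist (e g a) a) (𝓝 1) (𝓝 0) := by
      induction a using ind with
      | h s hs =>
        have := (ENNReal.tendsto_toReal ENNReal.zero_ne_top).comp (h_cont s hs)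
        exact this
    exact h2.comp h1
  exact tendsto_iff_dist_tendsto_zero.2 (hlim.congr fun g => (hdist g).symm)

/-- A whirly action on a nontrivial measure algebra has no atoms. -/
theorem IsWhirly.isAtomless {φ : BooleanAction G μ} (hφ : φ.IsWhirly) {s : Set X}
    (hs : MeasurableSet s) (h0 : μ s ≠ 0) (h1 : μ sᶜ ≠ 0) : IsAtomless μ := by
  intro a ha
  have ha0 := measure_pos ha.1
  have hcont : Tendsto (fun g => φ.act g a) (𝓝 1) (𝓝 a) := by
    have h1 : Continuous fun (T : Aut μ) (a : MeasureAlgebra μ) =>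
        (T : MeasureAlgebra μ ≃o MeasureAlgebra μ) a := continuous_induced_dom
    have h2 : Continuous fun g => φ.act g a :=
      (continuous_apply a).comp (h1.comp φ.continuous_toHom)
    have h3 : φ.act 1 a = a := by
      simp only [act, map_one]
      rfl
    simpa only [h3] using h2.tendsto 1
  have hV := hcont (Metric.ball_mem_nhds a ha0)
  -- The image of an atom is an atom; if it differed from `a` it would be disjoint from `a`, hence
  -- at distance at least `a.measure`.
  have hfix (g : G) (hg : φ.act g a ∈ Metric.ball a a.measure) : φ.act g a = a := by
    have hatom : IsAtom (φ.act g a) := (OrderIso.isAtom_iff _ a).2 ha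
    by_contra hne
    have hdisj : Disjoint a (φ.act g a) := ha.disjoint_of_ne hatom (Ne.symm hne)
    have hle : a ≤ φ.act g a ∆ a := by
      rw [hdisj.symm.symmDiff_eq_sup]
      exact le_sup_right
    exact absurd (measure_mono hle) (not_le.2 hg)
  -- Elements near `1` fix `a`, so whirliness makes `a` itself meet every set of positive measure.
  -- Yet an atom lies below `s` or `sᶜ`.
  have key (t : Set X) (ht : MeasurableSet t) (h : μ tᶜ ≠ 0) : ¬ a ≤ MeasureAlgebra.mk μ t ht := by
    intro hat
    obtain ⟨g, hg, hpos⟩ := hφ _ hV a (MeasureAlgebra.mk μ tᶜ ht.compl) ha0 ((measure_mk_pos_iff _).2 h)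
    rw [hfix g hg] at hpos
    have hbot : a ⊓ MeasureAlgebra.mk μ tᶜ ht.compl ≤ ⊥ :=
      (inf_le_inf_right _ hat).trans (inf_compl_eq_bot).le
    exact hpos.ne' (by rw [le_bot_iff.1 hbot, measure_bot])
  rcases ha.le_iff.1 (inf_le_left : a ⊓ MeasureAlgebra.mk μ s hs ≤ a) with h | h
  · refine key sᶜ hs.compl (by rwa [compl_compl]) ?_
    exact le_compl_iff_disjoint_right.2 (disjoint_iff.2 h)
  · exact key s hs h1 (inf_eq_left.1 h)

end BooleanAction

/-! ### Multiplication operators -/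

section MulLp

variable {X : Type*} [TopologicalSpace X] [MeasurableSpace X] [OpensMeasurableSpace X]
  {P : Measure X}

theorem memLp_circle_mul (g : C(X, Circle)) {f : X → ℂ} (hf : MemLp f 2 P) :
    MemLp (fun x => (g x : ℂ) * f x) 2 P := by
  refine hf.of_le ?_ (ae_of_all _ fun x => by rw [norm_mul, Circle.norm_coe, one_mul])
  have hg : Continuous fun x => (g x : ℂ) := continuous_induced_dom.comp g.continuous
  exact hg.aestronglyMeasurable.mul hf.aestronglyMeasurable

/-- Multiplication by a circle-valued function on the real Hilbert space `L²(P; ℂ)`. -/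
noncomputable def circleMulLp (P : Measure X) (g : C(X, Circle)) :
    Lp ℂ 2 P →ₗᵢ[ℝ] Lp ℂ 2 P where
  toFun f := (memLp_circle_mul g (Lp.memLp f)).toLp
  map_add' f₁ f₂ := by
    refine Lp.ext ?_
    filter_upwards [(memLp_circle_mul g (Lp.memLp (f₁ + f₂))).coeFn_toLp,
      (memLp_circle_mul g (Lp.memLp f₁)).coeFn_toLp,
      (memLp_circle_mul g (Lp.memLp f₂)).coeFn_toLp, Lp.coeFn_add f₁ f₂,
      Lp.coeFn_add (memLp_circle_mul g (Lp.memLp f₁)).toLp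
        (memLp_circle_mul g (Lp.memLp f₂)).toLp] with x h h₁ h₂ h₃ h₄
    rw [h, h₄, Pi.add_apply, h₁, h₂, h₃, Pi.add_apply, mul_add]
  map_smul' t f := by
    refine Lp.ext ?_
    filter_upwards [(memLp_circle_mul g (Lp.memLp (t • f))).coeFn_toLp,
      (memLp_circle_mul g (Lp.memLp f)).coeFn_toLp, Lp.coeFn_smul t f,
      Lp.coeFn_smul t (memLp_circle_mul g (Lp.memLp f)).toLp] with x h h₁ h₂ h₃
    rw [h, RingHom.id_apply, h₃, Pi.smul_apply, h₁, h₂, Pi.smul_apply, mul_smul_comm]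
  norm_map' f := by
    change ‖(memLp_circle_mul g (Lp.memLp f)).toLp‖ = ‖f‖
    rw [Lp.norm_toLp, Lp.norm_def]
    congr 1
    exact eLpNorm_congr_norm_ae (ae_of_all _ fun x => by rw [norm_mul, Circle.norm_coe, one_mul])

theorem coeFn_circleMulLp (g : C(X, Circle)) (f : Lp ℂ 2 P) :
    circleMulLp P g f =ᵐ[P] fun x => (g x : ℂ) * f x :=
  (memLp_circle_mul g (Lp.memLp f)).coeFn_toLp

theorem circleMulLp_one : circleMulLp P 1 = LinearIsometry.id := by
  refine LinearIsometry.ext fun f => Lp.ext ?_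
  filter_upwards [coeFn_circleMulLp 1 f] with x hx
  rw [hx]
  simp

theorem circleMulLp_comp (g h : C(X, Circle)) :
    (circleMulLp P h).comp (circleMulLp P g) = circleMulLp P (g * h) := by
  refine LinearIsometry.ext fun f => Lp.ext ?_
  filter_upwards [coeFn_circleMulLp h (circleMulLp P g f), coeFn_circleMulLp g f,
    coeFn_circleMulLp (g * h) f] with x h₁ h₂ h₃
  rw [h₃]
  refine h₁.trans ?_
  rw [h₂, ContinuousMap.mul_apply, Circle.coe_mul]
  ring

theorem norm_circleMulLp_sub_le (g : C(X, Circle)) {ε : ℝ}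
    (h : ∀ x, ‖(g x : ℂ) - 1‖ ≤ ε) (f : Lp ℂ 2 P) : ‖circleMulLp P g f - f‖ ≤ ε * ‖f‖ := by
  refine Lp.norm_le_mul_norm_of_ae_le_mul ?_
  filter_upwards [coeFn_circleMulLp g f, Lp.coeFn_sub (circleMulLp P g f) f] with x h₁ h₂
  rw [h₂, Pi.sub_apply, h₁]
  have h₃ : (g x : ℂ) * f x - f x = ((g x : ℂ) - 1) * f x := by ring
  rw [h₃, norm_mul]
  gcongr
  exact h x

end MulLp

/-! ### Walsh functions -/

namespace Cantor

/-- The fair coin. -/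
noncomputable def coin : Measure Bool := (PMF.uniformOfFintype Bool).toMeasure

instance : IsProbabilityMeasure coin :=
  inferInstanceAs (IsProbabilityMeasure (PMF.uniformOfFintype Bool).toMeasure)

/-- The coin-tossing measure on the Cantor space. -/
noncomputable def haar : Measure (ℕ → Bool) := Measure.infinitePi fun _ => coin

instance : IsProbabilityMeasure haar :=
  inferInstanceAs (IsProbabilityMeasure (Measure.infinitePi fun _ : ℕ => coin))

/-- The sign `1` or `-1` of a Boolean. -/
def sign (a : Bool) : ℝ := if a then 1 else -1

theorem sign_mul_self (a : Bool) : sign a * sign a = 1 := by cases a <;> simp [sign]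

theorem sign_eq (a : Bool) : sign a = 1 ∨ sign a = -1 := by cases a <;> simp [sign]

theorem continuous_sign : Continuous sign := continuous_of_discreteTopology

theorem integral_sign : ∫ a, sign a ∂coin = 0 := by
  rw [coin, PMF.integral_eq_sum]
  simp [sign]

/-- The Walsh functions on the Cantor space. -/
def walsh (F : Finset ℕ) (x : ℕ → Bool) : ℝ := ∏ i ∈ F, sign (x i)

theorem continuous_walsh (F : Finset ℕ) : Continuous (walsh F) :=
  continuous_finsetProd _ fun i _ => continuous_sign.comp (continuous_apply i)

theorem norm_walsh (F : Finset ℕ) (x : ℕ → Bool) : ‖walsh F x‖ = 1 := by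
  rw [walsh, norm_prod]
  refine Finset.prod_eq_one fun i _ => ?_
  rcases sign_eq (x i) with h | h <;> simp [h]

theorem walsh_mul (F G : Finset ℕ) (x : ℕ → Bool) : walsh F x * walsh G x = walsh (F ∆ G) x := by
  have key (A : Finset ℕ) (hA : A ⊆ F ∪ G) :
      walsh A x = ∏ i ∈ F ∪ G, if i ∈ A then sign (x i) else 1 := by
    rw [Finset.prod_ite_mem, Finset.inter_eq_right.2 hA, walsh]
  rw [key F Finset.subset_union_left, key G Finset.subset_union_right,
    key (F ∆ G) (fun i => by simp only [Finset.mem_symmDiff, Finset.mem_union]; tauto),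
    ← Finset.prod_mul_distrib]
  refine Finset.prod_congr rfl fun i _ => ?_
  by_cases h1 : i ∈ F <;> by_cases h2 : i ∈ G <;> simp [h1, h2, Finset.mem_symmDiff, sign_mul_self]

theorem integral_walsh (F : Finset ℕ) : ∫ x, walsh F x ∂haar = if F = ∅ then 1 else 0 := by
  have h1 := integral_restrict_infinitePi (μ := fun _ : ℕ => coin) (s := F)
    (f := fun y => ∏ i : F, sign (y i))
    (Continuous.aestronglyMeasurable (continuous_finsetProd _ fun i _ =>
      continuous_sign.comp (continuous_apply i)))
  have h2 (x : ℕ → Bool) : walsh F x = ∏ i : F, sign (F.restrict x i) :=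
    (Finset.prod_coe_sort F fun i => sign (x i)).symm
  simp only [h2, haar]
  rw [h1, integral_fintype_prod_eq_prod (μ := fun _ => coin) (f := fun (_ : F) y => sign y)]
  simp only [integral_sign]
  rw [Finset.prod_const, Finset.card_univ, Fintype.card_coe]
  split_ifs with h
  · simp [h]
  · exact zero_pow (by simpa using h)

/-- The indicator of a cylinder is the normalised product of the factors `1 + sign (a i) * sign (x
i)`, which expands into Walsh functions. Hence `φ` integrates to zero over cylinders, a generating
`π`-system. -/
theorem ae_eq_zero_of_integral_walsh_mul {φ : (ℕ → Bool) → ℝ} (hφ : Integrable φ haar)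
    (h : ∀ F, ∫ x, walsh F x * φ x ∂haar = 0) : φ =ᵐ[haar] 0 := by
  let E : Finset ℕ → (ℕ → Bool) → Set (ℕ → Bool) := fun F a => {x | ∀ i ∈ F, x i = a i}
  have hEm (F a) : MeasurableSet (E F a) := by
    have : E F a = ⋂ i ∈ F, (fun x => x i) ⁻¹' {a i} := by ext x; simp [E]
    rw [this]
    exact F.measurableSet_biInter fun i _ => measurable_pi_apply i (measurableSet_singleton _)
  have hint (F : Finset ℕ) : Integrable (fun x => walsh F x * φ x) haar :=
    hφ.bdd_mul (continuous_walsh F).aestronglyMeasurable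
      (ae_of_all _ fun x => (norm_walsh F x).le)
  have hE (F a) : ∫ x in E F a, φ x ∂haar = 0 := by
    have h1 (x : ℕ → Bool) : (E F a).indicator φ x
        = (2 ^ F.card : ℝ)⁻¹ * ∑ G ∈ F.powerset, walsh G a * (walsh G x * φ x) := by
      have h2 : ∑ G ∈ F.powerset, walsh G a * (walsh G x * φ x)
          = (∏ i ∈ F, (1 + sign (a i) * sign (x i))) * φ x := by
        rw [Finset.prod_one_add, Finset.sum_mul]
        refine Finset.sum_congr rfl fun G _ => ?_
        rw [Finset.prod_mul_distrib, walsh, walsh, mul_assoc]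
      rw [h2]
      by_cases hx : x ∈ E F a
      · rw [indicator_of_mem hx, Finset.prod_congr rfl fun i hi => by
          rw [hx i hi, sign_mul_self], Finset.prod_const]
        norm_num
      · rw [indicator_of_notMem hx]
        simp only [E, mem_ofPred_eq, not_forall] at hx
        obtain ⟨i, hi, hne⟩ := hx
        rw [Finset.prod_eq_zero hi, zero_mul, mul_zero]
        revert hne
        cases x i <;> cases a i <;> simp [sign]
    rw [← integral_indicator (hEm F a)]
    simp only [h1]
    rw [integral_const_mul, integral_finsetSum _ fun G _ => (hint G).const_mul _]
    simp [integral_const_mul, h]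
  have hgen : (MeasurableSpace.pi : MeasurableSpace (ℕ → Bool))
      = MeasurableSpace.generateFrom {s | ∃ F a, E F a = s} := by
    refine le_antisymm (iSup_le fun i => Measurable.comap_le ?_) (MeasurableSpace.generateFrom_le ?_)
    · refine @measurable_to_countable' Bool _ _ _ (MeasurableSpace.generateFrom _) _ fun c => ?_
      refine MeasurableSpace.measurableSet_generateFrom ⟨{i}, fun _ => c, ?_⟩
      ext x
      simp [E]
    · rintro _ ⟨F, a, rfl⟩
      exact hEm F a
  have hpi : IsPiSystem {s | ∃ F a, E F a = s} := by
    rintro _ ⟨F, a, rfl⟩ _ ⟨G, c, rfl⟩ ⟨z, hz1, hz2⟩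
    refine ⟨F ∪ G, z, ?_⟩
    ext x
    simp only [E, mem_inter_iff, mem_ofPred_eq, Finset.mem_union] at hz1 hz2 ⊢
    constructor
    · exact fun hx => ⟨fun i hi => (hx i (.inl hi)).trans (hz1 i hi),
        fun i hi => (hx i (.inr hi)).trans (hz2 i hi)⟩
    · rintro ⟨hx1, hx2⟩ i (hi | hi)
      · exact (hx1 i hi).trans (hz1 i hi).symm
      · exact (hx2 i hi).trans (hz2 i hi).symm
  have huniv : ∫ x, φ x ∂haar = 0 := by simpa [walsh] using h ∅
  refine hφ.ae_eq_zero_of_forall_setIntegral_eq_zero fun s hs _ => ?_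
  induction s, hs using MeasurableSpace.induction_on_inter hgen hpi with
  | empty => simp
  | basic t ht =>
    obtain ⟨F, a, rfl⟩ := ht
    exact hE F a
  | compl t ht ih =>
    have := integral_add_compl ht hφ
    rw [ih (measure_lt_top _ _)] at this
    linarith
  | iUnion f hd hf ih =>
    rw [integral_iUnion hf hd hφ.integrableOn]
    simp [fun i => ih i (measure_lt_top _ _)]

/-- The real orthonormal basis `1, I` of `ℂ`. -/
noncomputable def unit (β : Bool) : ℂ := if β then Complex.I else 1

theorem inner_unit (β β' : Bool) : inner ℝ (unit β) (unit β') = if β = β' then 1 else 0 := by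
  cases β <;> cases β' <;> simp [unit, Complex.inner]

theorem memLp_walsh (p : Finset ℕ × Bool) :
    MemLp (fun x => walsh p.1 x • unit p.2) 2 haar := by
  refine MemLp.of_bound (((continuous_walsh p.1).smul continuous_const).aestronglyMeasurable)
    ‖unit p.2‖ (ae_of_all _ fun x => ?_)
  rw [norm_smul, norm_walsh, one_mul]

theorem inner_walsh_toLp (p : Finset ℕ × Bool) (f : Lp ℂ 2 haar) :
    inner ℝ (memLp_walsh p).toLp f = ∫ x, walsh p.1 x * inner ℝ (unit p.2) (f x) ∂haar := by
  rw [L2.inner_def]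
  refine integral_congr_ae ?_
  filter_upwards [(memLp_walsh p).coeFn_toLp] with x hx
  rw [hx, real_inner_smul_left]

theorem orthonormal_walsh : Orthonormal ℝ fun p => (memLp_walsh p).toLp := by
  rw [orthonormal_iff_ite]
  rintro ⟨F, β⟩ ⟨G, β'⟩
  have h1 : inner ℝ (memLp_walsh (F, β)).toLp (memLp_walsh (G, β')).toLp
      = ∫ x, walsh (F ∆ G) x * inner ℝ (unit β) (unit β') ∂haar := by
    rw [inner_walsh_toLp]
    refine integral_congr_ae ?_
    filter_upwards [(memLp_walsh (G, β')).coeFn_toLp] with x hx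
    rw [hx, real_inner_smul_right, ← walsh_mul]
    ring
  rw [h1, integral_mul_const, integral_walsh, inner_unit]
  by_cases hF : F = G <;> by_cases hβ : β = β' <;> simp [hF, hβ, Finset.symmDiff_eq_empty]

theorem span_walsh_orthogonal :
    (Submodule.span ℝ (Set.range fun p => (memLp_walsh p).toLp))ᗮ = ⊥ := by
  rw [Submodule.eq_bot_iff]
  intro f hf
  have h0 (β : Bool) : (fun x => inner ℝ (unit β) (f x)) =ᵐ[haar] 0 := by
    refine ae_eq_zero_of_integral_walsh_mul ?_ fun F => ?_
    · exact ((innerSL ℝ (unit β)).integrable_comp ((Lp.memLp f).integrable (by norm_num)))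
    · rw [← inner_walsh_toLp (F, β) f]
      exact (Submodule.mem_orthogonal _ _).1 hf _ (Submodule.subset_span ⟨(F, β), rfl⟩)
  refine Lp.ext ?_
  filter_upwards [h0 false, h0 true, Lp.coeFn_zero ℂ 2 haar] with x h1 h2 h3
  rw [h3]
  refine Complex.ext ?_ ?_
  · simpa [unit, Complex.inner] using h1
  · simpa [unit, Complex.inner] using h2

/-- The Walsh functions and their multiples by `I` form a Hilbert basis of the real Hilbert space
`L²(ℕ → Bool; ℂ)`. -/
noncomputable def walshBasis : HilbertBasis (Finset ℕ × Bool) ℝ (Lp ℂ 2 haar) :=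
  HilbertBasis.mkOfOrthogonalEqBot orthonormal_walsh span_walsh_orthogonal

theorem walshBasis_apply (p : Finset ℕ × Bool) : walshBasis p = (memLp_walsh p).toLp := by
  simp [walshBasis]

/-- Multiplication by `exp (± I δ)`, with the sign of a coordinate `n`, acts on the Walsh functions
that do not depend on `n` as multiplication by `cos δ`, up to orthogonal directions. -/
theorem inner_walshBasis_circleMulLp (g : C(ℕ → Bool, Circle)) {c s : ℝ} {n : ℕ}
    (h : ∀ x, (g x : ℂ) = c + (sign (x n) * s : ℝ) * Complex.I) (p q : Finset ℕ × Bool)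
    (hp : n ∉ p.1) (hq : n ∉ q.1) :
    inner ℝ (walshBasis p) (circleMulLp haar g (walshBasis q)) = if p = q then c else 0 := by
  have h1 : inner ℝ (walshBasis p) (circleMulLp haar g (walshBasis q))
      = ∫ x, (walsh (p.1 ∆ q.1) x * (c * inner ℝ (unit p.2) (unit q.2))
        + walsh (p.1 ∆ q.1 ∆ {n}) x * (s * inner ℝ (unit p.2) (Complex.I * unit q.2))) ∂haar := by
    rw [walshBasis_apply, walshBasis_apply, inner_walsh_toLp]
    refine integral_congr_ae ?_
    filter_upwards [(memLp_walsh q).coeFn_toLp,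
      coeFn_circleMulLp g (memLp_walsh q).toLp] with x h1 h2
    have h3 : (g x : ℂ) * (walsh q.1 x • unit q.2) = (walsh q.1 x * c) • unit q.2
        + (walsh q.1 x * (sign (x n) * s)) • (Complex.I * unit q.2) := by
      rw [h x]
      simp only [Complex.real_smul]
      push_cast
      ring
    rw [h2, h1, h3, inner_add_right, real_inner_smul_right, real_inner_smul_right,
      ← walsh_mul (p.1 ∆ q.1), ← walsh_mul]
    simp only [walsh, Finset.prod_singleton]
    ring
  -- The sine part carries the extra factor `sign (x n)`, which nothing cancels, so it integrates to
  -- zero.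
  have hne : p.1 ∆ q.1 ∆ {n} ≠ ∅ := by
    rw [← Finset.nonempty_iff_ne_empty]
    exact ⟨n, by simp [Finset.mem_symmDiff, hp, hq]⟩
  have hi (F : Finset ℕ) (t : ℝ) : Integrable (fun x => walsh F x * t) haar :=
    (Integrable.of_bound (continuous_walsh F).aestronglyMeasurable 1
      (ae_of_all _ fun x => (norm_walsh F x).le)).mul_const t
  rw [h1, integral_add (hi _ _) (hi _ _), integral_mul_const, integral_mul_const, integral_walsh,
    integral_walsh, if_neg hne, inner_unit]
  obtain ⟨F, β⟩ := p
  obtain ⟨G, β'⟩ := q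
  by_cases hF : F = G <;> by_cases hβ : β = β' <;> simp [hF, hβ, Finset.symmDiff_eq_empty]

end Cantor

/-! ### The action of `C(M, Circle)` -/

section Action

variable {M : Type*} [MetricSpace M]

/-- Every neighbourhood of `1` in `C(M, Circle)` contains functions taking prescribed values
`exp (± I δ)` on an embedded Cantor space. -/
theorem exists_mem_nhds_one_eq_on_cantor [CompactSpace M] {j : (ℕ → Bool) → M} (hj : IsClosedEmbedding j)
    {V : Set C(M, Circle)} (hV : V ∈ 𝓝 1) :
    ∃ δ : ℝ, Real.sin δ ≠ 0 ∧ ∀ n : ℕ, ∃ g ∈ V, ∀ x, (g (j x) : ℂ)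
      = Real.cos δ + (Cantor.sign (x n) * Real.sin δ : ℝ) * Complex.I := by
  have hcont : Continuous fun f : C(M, ℝ) => Circle.exp.comp f :=
    ContinuousMap.continuous_postcomp Circle.exp
  have h0 : Circle.exp.comp (0 : C(M, ℝ)) = 1 := by ext; simp
  have hV' : (fun f : C(M, ℝ) => Circle.exp.comp f) ⁻¹' V ∈ 𝓝 0 :=
    hcont.continuousAt.preimage_mem_nhds (by rwa [h0])
  obtain ⟨ε, hε, hball⟩ := Metric.mem_nhds_iff.1 hV'
  -- `δ < ε` keeps the extension in `V`, and `δ < π` makes `sin δ` nonzero. The choice does not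
  -- depend on `n`.
  obtain ⟨δ, hδ0, hδ⟩ := exists_between (lt_min hε Real.pi_pos)
  refine ⟨δ, (Real.sin_pos_of_pos_of_lt_pi hδ0 (hδ.trans_le (min_le_right _ _))).ne', fun n => ?_⟩
  let r : C(ℕ → Bool, ℝ) :=
    ⟨fun x => Cantor.sign (x n) * δ,
      (Cantor.continuous_sign.comp (continuous_apply n)).mul continuous_const⟩
  have hr (x : ℕ → Bool) : r x ∈ Icc (-δ) δ := by
    change Cantor.sign (x n) * δ ∈ _
    rcases Cantor.sign_eq (x n) with h | h <;> simp [h, hδ0.le]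
  -- Tietze extension is applied to the real phase, with values kept in `[-δ, δ]`, so that the
  -- extension is uniformly small on all of `M`.
  obtain ⟨f, hf, hfr⟩ := r.exists_extension_forall_mem_of_isClosedEmbedding hr
    ⟨0, by simp [hδ0.le]⟩ hj
  refine ⟨Circle.exp.comp f, hball ?_, fun x => ?_⟩
  · rw [mem_ball_zero_iff]
    refine lt_of_le_of_lt ((ContinuousMap.norm_le f hδ0.le).2 fun y => ?_)
      (hδ.trans_le (min_le_left _ _))
    exact abs_le.2 (hf y)
  · have hx : f (j x) = Cantor.sign (x n) * δ := congrFun hfr x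
    rw [ContinuousMap.comp_apply, hx, Circle.coe_exp, Complex.exp_mul_I, ← Complex.ofReal_cos,
      ← Complex.ofReal_sin]
    rcases Cantor.sign_eq (x n) with h | h <;> simp [h]

/-- The isometry of `L²(ℕ → Bool; ℂ)` given by multiplication by the restriction of `g` to an
embedded Cantor space. -/
noncomputable def cantorMul (j : C(ℕ → Bool, M)) (g : C(M, Circle)) :
    Lp ℂ 2 Cantor.haar →ₗᵢ[ℝ] Lp ℂ 2 Cantor.haar :=
  circleMulLp Cantor.haar (g.comp j)

theorem cantorMul_one (j : C(ℕ → Bool, M)) : cantorMul j 1 = LinearIsometry.id :=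
  circleMulLp_one

theorem cantorMul_mul (j : C(ℕ → Bool, M)) (g h : C(M, Circle)) :
    cantorMul j (g * h) = (cantorMul j h).comp (cantorMul j g) :=
  (circleMulLp_comp (g.comp j) (h.comp j)).symm

theorem tendsto_cantorMul [CompactSpace M] (j : C(ℕ → Bool, M)) (f : Lp ℂ 2 Cantor.haar) :
    Tendsto (fun g => cantorMul j g f) (𝓝 1) (𝓝 f) := by
  let coe : C(Circle, ℂ) := ⟨fun z => z, continuous_induced_dom⟩
  have hcont : Tendsto (fun g : C(M, Circle) => coe.comp g) (𝓝 1) (𝓝 (coe.comp 1)) :=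
    (ContinuousMap.continuous_postcomp coe).tendsto 1
  rw [Metric.tendsto_nhds] at hcont ⊢
  intro ε hε
  have hpos : 0 < ε / (‖f‖ + 1) := by positivity
  filter_upwards [hcont _ hpos] with g hg
  rw [dist_eq_norm]
  calc ‖cantorMul j g f - f‖ ≤ ε / (‖f‖ + 1) * ‖f‖ :=
        norm_circleMulLp_sub_le _ (fun x =>
          (ContinuousMap.norm_coe_le_norm (coe.comp g - coe.comp 1) (j x)).trans
            ((dist_eq_norm _ _).symm.trans_le hg.le)) f
    _ < ε / (‖f‖ + 1) * (‖f‖ + 1) := by gcongr; linarith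
    _ = ε := div_mul_cancel₀ _ (by positivity)

/-- The Boolean action of `C(M, Circle)` on the Gaussian measure algebra over `L²(ℕ → Bool; ℂ)`,
on which `C(M, Circle)` acts by multiplication through an embedded Cantor space. -/
noncomputable def gaussianAction [CompactSpace M] (j : C(ℕ → Bool, M)) :
    BooleanAction C(M, Circle) (gaussianPi (Finset ℕ × Bool)) :=
  BooleanAction.ofNearAction (fun g => gaussianPi.rotate Cantor.walshBasis (cantorMul j g))
    (fun _ => gaussianPi.measurePreserving_rotate _ _)
    (by rw [cantorMul_one]; exact gaussianPi.rotate_id _)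
    (fun g h => by rw [cantorMul_mul]; exact gaussianPi.rotate_comp _ _ _)
    (fun _ hs => gaussianPi.tendsto_measure_rotate_symmDiff _ (tendsto_cantorMul j) hs)

theorem gaussianAction_isWhirly [CompactSpace M] (j : C(ℕ → Bool, M)) (hj : IsClosedEmbedding j) :
    (gaussianAction j).IsWhirly := by
  intro V hV a b ha hb
  induction a using MeasureAlgebra.ind with
  | h A hA =>
  induction b using MeasureAlgebra.ind with
  | h B hB =>
  rw [MeasureAlgebra.measure_mk_pos_iff] at ha hb
  obtain ⟨δ, hδ, hex⟩ := exists_mem_nhds_one_eq_on_cantor hj hV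
  -- `A` and `B` are exchanged because `g` acts on the algebra by preimage. As `δ` is fixed before
  -- `F`, a coordinate `n` avoiding every Walsh index in `F` can still be chosen.
  obtain ⟨F, hF⟩ := gaussianPi.exists_finset_forall_measure_inter_pos Cantor.walshBasis
    (Real.cos_sq_add_sin_sq δ) hδ hB hA hb ha
  obtain ⟨n, hn⟩ := (F.biUnion fun p => p.1).exists_notMem
  simp only [Finset.mem_biUnion, not_exists, not_and] at hn
  obtain ⟨g, hgV, hg⟩ := hex n
  refine ⟨g, hgV, ?_⟩
  have := hF (cantorMul j g) fun p hp q hq =>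
    Cantor.inner_walshBasis_circleMulLp _ hg p q (hn p hp) (hn q hq)
  rw [inter_comm] at this
  exact this

theorem gaussianPi_measure_preimage_ne_zero {ι : Type*} (i : ι) {s : Set ℝ} (hs : MeasurableSet s)
    (h : volume s ≠ 0) : gaussianPi ι ((fun x => x i) ⁻¹' s) ≠ 0 := by
  have h1 : gaussianPi ι ((fun x => x i) ⁻¹' s) = gaussianReal 0 1 s :=
    (measurePreserving_eval_infinitePi (fun _ : ι => gaussianReal 0 1) i).measure_preimage
      hs.nullMeasurableSet
  rw [h1]
  exact fun h0 => h (gaussianReal_absolutelyContinuous' 0 one_ne_zero h0)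

end Action

/-- The group `C(M, Circle)` carries pointwise multiplication and the compact-open topology, which
for compact `M` is the topology of uniform convergence. -/
theorem theorem1p1 (M : Type*) [MetricSpace M] [CompactSpace M] [Uncountable M] :
    ∃ (X : Type) (_ : MeasurableSpace X) (_ : StandardBorelSpace X)
      (μ : Measure X) (_ : IsProbabilityMeasure μ),
      TopologicalSpace.SeparableSpace (MeasureAlgebra μ) ∧
      MeasureAlgebra.IsAtomless μ ∧
      ∃ φ : BooleanAction C(M, Circle) μ, φ.IsWhirly := by
  obtain ⟨j, -, hjc, hji⟩ := isClosed_univ.exists_nat_bool_injection_of_not_countable (α := M)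
    not_countable_univ
  have hwhirly := gaussianAction_isWhirly ⟨j, hjc⟩ (hjc.isClosedEmbedding hji)
  refine ⟨Finset ℕ × Bool → ℝ, inferInstance, inferInstance, gaussianPi _, inferInstance,
    inferInstance, ?_, _, hwhirly⟩
  -- A half-space and its complement both have positive measure, so the algebra is nontrivial.
  have hs : MeasurableSet ((fun x : Finset ℕ × Bool → ℝ => x (∅, true)) ⁻¹' Iic 0) :=
    measurable_pi_apply _ measurableSet_Iic
  refine hwhirly.isAtomless hs (gaussianPi_measure_preimage_ne_zero _ measurableSet_Iic (by simp)) ?_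
  rw [← preimage_compl]
  exact gaussianPi_measure_preimage_ne_zero _ measurableSet_Iic.compl (by simp)
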